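/- Let $G=\mathbb{F}_5^n$ (with $n\ge 0$ an integer). Functions $\phi_1,\dots,\phi_k:G\to\mathbb{F}_5$ generate a $\sigma$-algebra on $G$ whose atoms are the non-empty sets $\{x:\phi_1(x)=c_1,\dots,\phi_k(x)=c_k\}$; a $\sigma$-algebra $\mathcal{B}'$ refines $\mathcal{B}$ if every atom of $\mathcal{B}'$ is contained in an atom of $\mathcal{B}$. For $f:G\to\mathbb{R}$, $\mathbb{E}(f|\mathcal{B})(x)$ denotes the average of $f$ over the atom of $\mathcal{B}$ containing $x$. A quadratic factor of complexity $(d_1,d_2)$ is a pair $(\mathcal{B}_1,\mathcal{B}_2)$ for which there are vectors $r_1,\dots,r_{d_1}\in G$ and symmetric $n\times n$ matrices $M_1,\dots,M_{d_2}$ over $\mathbb{F}_5$ such that $\mathcal{B}_1$ is generated by the functions $r_j^Tx$ and $\mathcal{B}_2$ by the functions $r_j^Tx$ and $x^TM_jx$; it has complexity at most $(d_1,d_2)$ if it has complexity $(e_1,e_2)$ for some $e_1\le d_1$, $e_2\le d_2$. The pair $(\mathcal{B}_1,\mathcal{B}_2)$ refines $(\mathcal{B}_1',\mathcal{B}_2')$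 if $\mathcal{B}_i$ refines $\mathcal{B}_i'$ for $i=1,2$. The Gowers $U^3$-norm $\|f\|_{U^3}\ge 0$ of $f:G\to\mathbb{R}$ is given by \[ \|f\|_{U^3}^8=\mathbb{E}_{x,h_1,h_2,h_3\in G}\,f(x)f(x+h_1)f(x+h_2)f(x+h_3)f(x+h_1+h_2)f(x+h_1+h_3)f(x+h_2+h_3)f(x+h_1+h_2+h_3), \] where $\mathbb{E}$ denotes the average. **Quadratic Koopman–von Neumann decomposition.** For every $\delta>0$ there is a constant $C=C(\delta)$, depending only on $\delta$, such that the following holds for all $n,d_1^{(0)},d_2^{(0)}\ge 0$. Let $(\mathcal{B}_1^{(0)},\mathcal{B}_2^{(0)})$ be a quadratic factor on $\mathbb{F}_5^n$ of complexity at most $(d_1^{(0)},d_2^{(0)})$ and let $f:\mathbb{F}_5^n\to[-1,1]$ be a function. Then there is a quadratic factor $(\mathcal{B}_1,\mathcal{B}_2)$ of complexity at most $(d_1^{(0)}+C,\,d_2^{(0)}+C)$ which refines $(\mathcal{B}_1^{(0)},\mathcal{B}_2^{(0)})$, and such that $f=f_1+f_2$, where $f_1=\mathbb{E}(f|\mathcal{B}_2)$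 and $\|f_2\|_{U^3}\le\delta$. -/

import Mathlib

open scoped BigOperators Matrix

/-- The vector space `𝔽₅ⁿ`. -/
abbrev F5Vec (n : ℕ) : Type := Fin n → ZMod 5

/-- The factor described by functions `φ i : 𝔽₅ⁿ → 𝔽₅`: the σ-algebra generated by them, whose
members are the unions of the sets `{x | ∀ i, φ i x = c i}`. -/
def factorOf {n : ℕ} {ι : Type} (φ : ι → F5Vec n → ZMod 5) : MeasurableSpace (F5Vec n) :=
  MeasurableSpace.comap (fun x i => φ i x) ⊤

/-- `B(x)`, the atom of `B` which contains `x`. -/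
def atomOf {n : ℕ} (B : MeasurableSpace (F5Vec n)) (x : F5Vec n) : Set (F5Vec n) :=
  @measurableAtom (F5Vec n) B x

theorem atomOf_factorOf {n : ℕ} {ι : Type} (φ : ι → F5Vec n → ZMod 5) (x : F5Vec n) :
    atomOf (factorOf φ) x = {y | ∀ i, φ i y = φ i x} := by
  ext y
  simp only [atomOf, measurableAtom, Set.mem_iInter, Set.mem_setOf_eq]
  constructor
  · intro h i
    exact h {z | φ i z = φ i x} rfl ⟨{c | c i = φ i x}, trivial, rfl⟩
  · rintro h s hx ⟨t, -, rfl⟩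
    have : (fun i => φ i y) = (fun i => φ i x) := funext h
    simpa [this] using hx

/-- `B'` refines `B`: every atom of `B'` is contained in an atom of `B`. -/
def RefinesFactor {n : ℕ} (B' B : MeasurableSpace (F5Vec n)) : Prop :=
  ∀ x, ∃ z, atomOf B' x ⊆ atomOf B z

open Classical in
/-- The conditional expectation `𝔼(f|B)`: its value at `x` is the average of `f` over the atom of
`B` which contains `x`. -/
noncomputable def condAvg {n : ℕ} (f : F5Vec n → ℝ) (B : MeasurableSpace (F5Vec n)) :
    F5Vec n → ℝ :=
  fun x => 𝔼 y ∈ Finset.univ.filter (fun y => y ∈ atomOf B x), f y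

/-- The linear factor generated by the functions `rⱼᵀ x`. -/
def linearFactor {n d₁ : ℕ} (r : Fin d₁ → F5Vec n) : MeasurableSpace (F5Vec n) :=
  factorOf (fun (j : Fin d₁) x => r j ⬝ᵥ x)

/-- The σ-algebra generated by the functions `rⱼᵀ x` and `xᵀ Mⱼ x`. -/
def linQuadFactor {n d₁ d₂ : ℕ} (r : Fin d₁ → F5Vec n)
    (M : Fin d₂ → Matrix (Fin n) (Fin n) (ZMod 5)) : MeasurableSpace (F5Vec n) :=
  factorOf (Sum.elim (fun (j : Fin d₁) x => r j ⬝ᵥ x) (fun (j : Fin d₂) x => x ⬝ᵥ (M j *ᵥ x)))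

/-- `(B₁, B₂)` is a (homogeneous) quadratic factor of complexity `(d₁, d₂)`. -/
def IsQuadraticFactor {n : ℕ} (B₁ B₂ : MeasurableSpace (F5Vec n)) (d₁ d₂ : ℕ) : Prop :=
  ∃ (r : Fin d₁ → F5Vec n) (M : Fin d₂ → Matrix (Fin n) (Fin n) (ZMod 5)),
    (∀ j, (M j).IsSymm) ∧ B₁ = linearFactor r ∧ B₂ = linQuadFactor r M

/-- `(B₁, B₂)` is a quadratic factor of complexity at most `(d₁, d₂)`. -/
def IsQuadraticFactorLE {n : ℕ} (B₁ B₂ : MeasurableSpace (F5Vec n)) (d₁ d₂ : ℕ) : Prop :=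
  ∃ e₁ e₂ : ℕ, e₁ ≤ d₁ ∧ e₂ ≤ d₂ ∧ IsQuadraticFactor B₁ B₂ e₁ e₂

/-- The eighth power of the Gowers `U³`-norm. -/
noncomputable def gowersU3Pow {n : ℕ} (f : F5Vec n → ℝ) : ℝ :=
  𝔼 x : F5Vec n, 𝔼 h₁ : F5Vec n, 𝔼 h₂ : F5Vec n, 𝔼 h₃ : F5Vec n,
    f x * f (x + h₁) * f (x + h₂) * f (x + h₃) * f (x + h₁ + h₂) * f (x + h₁ + h₃) *
      f (x + h₂ + h₃) * f (x + h₁ + h₂ + h₃)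

theorem gowersU3Pow_nonneg {n : ℕ} (f : F5Vec n → ℝ) : 0 ≤ gowersU3Pow f := by
  have key : gowersU3Pow f = 𝔼 h₁ : F5Vec n, 𝔼 h₂ : F5Vec n,
      (𝔼 x : F5Vec n, f x * f (x + h₁) * f (x + h₂) * f (x + h₁ + h₂)) ^ 2 := by
    unfold gowersU3Pow
    rw [Finset.expect_comm]
    refine Finset.expect_congr rfl fun h₁ _ => ?_
    rw [Finset.expect_comm]
    refine Finset.expect_congr rfl fun h₂ _ => ?_
    rw [sq, Finset.expect_mul_expect]
    refine Finset.expect_congr rfl fun x _ => ?_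
    refine Fintype.expect_equiv (Equiv.addLeft x) _ _ fun h₃ => ?_
    simp only [Equiv.coe_addLeft]
    rw [add_right_comm x h₁ h₃, add_right_comm x h₂ h₃, add_right_comm (x + h₁) h₂ h₃,
      add_right_comm x h₁ h₃]
    ring
  rw [key]
  exact Finset.expect_nonneg fun _ _ => Finset.expect_nonneg fun _ _ => sq_nonneg _

/-- The Gowers `U³`-norm of a real function on `𝔽₅ⁿ`. -/
noncomputable def gowersU3 {n : ℕ} (f : F5Vec n → ℝ) : ℝ :=
  gowersU3Pow f ^ (1 / 8 : ℝ)

/-!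
If the part `f - 𝔼(f|B)` of `f` not seen by a quadratic factor `B` has large `U³`-norm, the inverse
theorem for the `U³`-norm gives a quadratic form `q` and boundedly many linear forms such that
`f - 𝔼(f|B)` correlates with a function of these. Joining them to `B` raises the energy
`𝔼 |𝔼(f|B)|²`, which is at most `1`, by a fixed amount, so this happens boundedly often.

For the inverse theorem, a large `U³`-norm of `f` means that for many `h` the derivative
`x ↦ conj (f x) * f (x + h)` has a large Fourier coefficient, at a frequency `χ h`. Two applications
of the Cauchy–Schwarz inequality show that the graph of `χ` has many additive quadruples; by the
theorems of Balog–Szemerédi–Gowers and Freiman it then agrees often with an affine map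
`h ↦ B h + b`. Dividing `f` by the quadratic phase of the symmetric part of `B` leaves a function
`u` whose derivatives correlate with the antisymmetric part `A`. A further Cauchy–Schwarz argument
shows that `A` has bounded rank, and on the fibres of `A` the bilinear phase becomes linear, whence
`u` correlates with a linear phase times a function of `A`, and `f` with a function of `q` and of
boundedly many linear forms.
-/

section Averages

open Finset ComplexConjugate

variable {ι κ : Type*} [Fintype ι] [Fintype κ]

theorem ofReal_norm_expect_sq (g : ι → ℂ) :
    ((‖𝔼 x, g x‖ ^ 2 : ℝ) : ℂ) = 𝔼 x, 𝔼 y, g x * conj (g y) := by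
  rw [Complex.ofReal_pow, ← Complex.mul_conj', map_expect, expect_mul_expect]

theorem sq_norm_ofReal (s : ℝ) : ‖(s : ℂ)‖ ^ 2 = s ^ 2 := by
  rw [Complex.norm_real, Real.norm_eq_abs, sq_abs]

theorem expect_eq_expect_add_left {G M : Type*} [AddGroup G] [Fintype G] [AddCommMonoid M]
    [Module ℚ≥0 M] (x : G) (f : G → M) : 𝔼 y, f y = 𝔼 k, f (x + k) :=
  (Fintype.expect_equiv (Equiv.addLeft x) _ _ fun _ => rfl).symm

theorem sq_expect_le_expect_sq [Nonempty ι] (g : ι → ℝ) : (𝔼 x, g x) ^ 2 ≤ 𝔼 x, g x ^ 2 := by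
  simpa using expect_mul_sq_le_sq_mul_sq univ g fun _ => 1

theorem norm_expect_le_one [Nonempty ι] {g : ι → ℂ} (hg : ∀ x, ‖g x‖ ≤ 1) : ‖𝔼 x, g x‖ ≤ 1 :=
  (RCLike.norm_expect_le (K := ℂ)).trans (expect_le univ_nonempty fun x _ => hg x)

theorem norm_mul_le_one {a b : ℂ} (ha : ‖a‖ ≤ 1) (hb : ‖b‖ ≤ 1) : ‖a * b‖ ≤ 1 := by
  rw [norm_mul]
  exact mul_le_one₀ ha (norm_nonneg _) hb

theorem norm_expect_mul_sq_le [Nonempty ι] {a b : ι → ℂ} (ha : ∀ i, ‖a i‖ ≤ 1) :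
    ‖𝔼 i, a i * b i‖ ^ 2 ≤ 𝔼 i, ‖b i‖ ^ 2 := by
  have h : ‖𝔼 i, a i * b i‖ ≤ 𝔼 i, ‖b i‖ := by
    refine (RCLike.norm_expect_le (K := ℂ)).trans (expect_le_expect fun i _ => ?_)
    rw [norm_mul]
    exact mul_le_of_le_one_left (norm_nonneg _) (ha i)
  calc ‖𝔼 i, a i * b i‖ ^ 2 ≤ (𝔼 i, ‖b i‖) ^ 2 := by gcongr
    _ ≤ 𝔼 i, ‖b i‖ ^ 2 := sq_expect_le_expect_sq _

theorem norm_expect_expect_mul_sq_le [Nonempty ι] [Nonempty κ] {a b : ι → κ → ℂ}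
    (ha : ∀ i j, ‖a i j‖ ≤ 1) :
    ‖𝔼 i, 𝔼 j, a i j * b i j‖ ^ 2 ≤ 𝔼 i, 𝔼 j, ‖b i j‖ ^ 2 := by
  calc ‖𝔼 i, 𝔼 j, a i j * b i j‖ ^ 2 ≤ 𝔼 i, ‖𝔼 j, a i j * b i j‖ ^ 2 := by
        simpa using norm_expect_mul_sq_le (a := fun _ : ι => 1)
          (b := fun i => 𝔼 j, a i j * b i j) (by simp)
    _ ≤ 𝔼 i, 𝔼 j, ‖b i j‖ ^ 2 := expect_le_expect fun i _ => norm_expect_mul_sq_le (ha i)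

theorem exists_finset_of_two_mul_le_expect {g : ι → ℝ} (hg : ∀ x, g x ≤ 1) {c : ℝ}
    (hc0 : 0 ≤ c) (hc : 2 * c ≤ 𝔼 x, g x) :
    ∃ H : Finset ι, (∀ h ∈ H, c ≤ g h) ∧ c * Fintype.card ι ≤ #H := by
  classical
  refine ⟨({h | c ≤ g h} : Finset ι), fun h hh => (mem_filter.1 hh).2, ?_⟩
  have hsum : 2 * c * Fintype.card ι ≤ ∑ x, g x := by
    rw [← Fintype.card_mul_expect, mul_comm]
    gcongr
  have hle : ∑ x, g x ≤ ∑ x, ((if c ≤ g x then (1 : ℝ) else 0) + c) := by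
    refine sum_le_sum fun x _ => ?_
    split_ifs
    · linarith [hg x]
    · linarith
  rw [sum_add_distrib, sum_boole, sum_const, nsmul_eq_mul, card_univ] at hle
  linarith

end Averages

section Fourier

open Finset ComplexConjugate

theorem norm_mul_addChar_apply {G : Type*} [AddCommGroup G] [Finite G] (u : G → ℂ)
    (χ : AddChar G ℂ) (x : G) : ‖u x * χ x‖ = ‖u x‖ := by
  rw [norm_mul, AddChar.norm_apply, mul_one]

variable {G : Type*} [AddCommGroup G] [Fintype G]

theorem sum_addChar_apply_sub_eq_ite [DecidableEq G] (x y : G) :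
    ∑ χ : AddChar G ℂ, χ (x - y) = if x = y then (Fintype.card G : ℂ) else 0 := by
  rw [AddChar.sum_apply_eq_ite]
  simp only [sub_eq_zero]

theorem expect_mul_sum_addChar_apply_sub (u : G → ℂ) (t : G) :
    𝔼 x, u x * ∑ χ : AddChar G ℂ, χ (x - t) = u t := by
  classical
  have hcard : (Fintype.card G : ℂ) ≠ 0 := by exact_mod_cast Fintype.card_ne_zero
  simp only [sum_addChar_apply_sub_eq_ite, Fintype.expect_eq_sum_div_card, mul_ite, mul_zero,
    sum_ite_eq', mem_univ, if_true]
  field_simp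

/-- The Fourier coefficient `𝔼 u χ` of `u` at the character `χ`, without a conjugate: it measures
the correlation of `u` with `χ⁻¹`. -/
noncomputable def charCoeff (u : G → ℂ) (χ : AddChar G ℂ) : ℂ := 𝔼 x, u x * χ x

theorem sum_charCoeff_mul_apply_neg (u : G → ℂ) (t : G) :
    ∑ χ, charCoeff u χ * χ (-t) = u t := by
  simp only [charCoeff, expect_mul]
  rw [← expect_sum_comm, ← expect_mul_sum_addChar_apply_sub u t]
  simp only [mul_sum, sub_eq_add_neg, AddChar.map_add_eq_mul, mul_assoc]

theorem sum_norm_charCoeff_sq (u : G → ℂ) : ∑ χ, ‖charCoeff u χ‖ ^ 2 = 𝔼 x, ‖u x‖ ^ 2 := by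
  apply Complex.ofReal_injective
  rw [Complex.ofReal_sum, Complex.ofReal_expect]
  simp only [charCoeff, ofReal_norm_expect_sq]
  rw [← expect_sum_comm, expect_congr rfl]
  intro y _
  rw [← expect_sum_comm, Complex.ofReal_pow, ← Complex.mul_conj',
    ← expect_mul_sum_addChar_apply_sub (fun z => u y * conj (u z)) y]
  refine expect_congr rfl fun x _ => ?_
  have hflip : ∑ χ : AddChar G ℂ, χ (x - y) = ∑ χ : AddChar G ℂ, χ (y - x) :=
    Fintype.sum_equiv (Equiv.neg _) _ _ fun χ => by simp
  rw [hflip, mul_sum]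
  refine sum_congr rfl fun χ _ => ?_
  rw [map_mul, ← AddChar.map_neg_eq_conj, sub_eq_add_neg, AddChar.map_add_eq_mul]
  ring

theorem norm_charCoeff_le_one {u : G → ℂ} (hu : ∀ x, ‖u x‖ ≤ 1) (χ : AddChar G ℂ) :
    ‖charCoeff u χ‖ ≤ 1 :=
  norm_expect_le_one fun x => (norm_mul_addChar_apply u χ x).trans_le (hu x)

theorem sum_norm_charCoeff_sq_le_one {u : G → ℂ} (hu : ∀ x, ‖u x‖ ≤ 1) :
    ∑ χ, ‖charCoeff u χ‖ ^ 2 ≤ 1 := by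
  rw [sum_norm_charCoeff_sq]
  exact expect_le univ_nonempty fun x _ => pow_le_one₀ (norm_nonneg _) (hu x)

theorem expect_mul_mul_mul_eq_sum_charCoeff (u₁ u₂ u₃ u₄ : G → ℂ) :
    𝔼 a, 𝔼 b, 𝔼 c, u₁ a * u₂ b * u₃ c * u₄ (b + c - a) =
      ∑ χ, charCoeff u₁ χ * charCoeff u₂ (-χ) * charCoeff u₃ (-χ) * charCoeff u₄ χ := by
  have h : ∀ a b c, u₁ a * u₂ b * u₃ c * u₄ (b + c - a) = ∑ χ : AddChar G ℂ,
      charCoeff u₄ χ * ((u₁ a * χ a) * ((u₂ b * (-χ) b) * (u₃ c * (-χ) c))) := by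
    intro a b c
    rw [← sum_charCoeff_mul_apply_neg u₄ (b + c - a), mul_sum]
    refine sum_congr rfl fun χ _ => ?_
    have hneg : -(b + c - a) = a + (-b + -c) := by abel
    rw [hneg, AddChar.map_add_eq_mul, AddChar.map_add_eq_mul, AddChar.neg_apply,
      AddChar.neg_apply]
    ring
  simp only [h, expect_sum_comm, ← mul_expect, ← expect_mul]
  refine sum_congr rfl fun χ _ => ?_
  simp only [charCoeff]
  ring

theorem exists_le_norm_charCoeff {u₁ u₂ u₃ u₄ : G → ℂ} (h₂ : ∀ x, ‖u₂ x‖ ≤ 1)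
    (h₃ : ∀ x, ‖u₃ x‖ ≤ 1) (h₄ : ∀ x, ‖u₄ x‖ ≤ 1) :
    ∃ χ, ‖𝔼 a, 𝔼 b, 𝔼 c, u₁ a * u₂ b * u₃ c * u₄ (b + c - a)‖ ≤ ‖charCoeff u₁ χ‖ := by
  obtain ⟨χ₀, hχ₀⟩ := Finite.exists_max fun χ => ‖charCoeff u₁ χ‖
  have hneg : ∀ u : G → ℂ, (∀ x, ‖u x‖ ≤ 1) → ∑ χ, ‖charCoeff u (-χ)‖ ^ 2 ≤ 1 := fun u hu =>
    (Fintype.sum_equiv (Equiv.neg _) _ _ fun _ => rfl).trans_le (sum_norm_charCoeff_sq_le_one hu)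
  refine ⟨χ₀, ?_⟩
  rw [expect_mul_mul_mul_eq_sum_charCoeff]
  calc _ ≤ ∑ χ, ‖charCoeff u₁ χ₀‖ *
        ((‖charCoeff u₂ (-χ)‖ ^ 2 + ‖charCoeff u₃ (-χ)‖ ^ 2) / 2) := by
        refine norm_sum_le_of_le _ fun χ _ => ?_
        rw [norm_mul, norm_mul, norm_mul, mul_assoc, mul_assoc]
        have hmax := hχ₀ χ
        gcongr
        calc _ ≤ ‖charCoeff u₂ (-χ)‖ * (‖charCoeff u₃ (-χ)‖ * 1) := by
              gcongr
              exact norm_charCoeff_le_one h₄ χ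
          _ ≤ _ := by nlinarith [sq_nonneg (‖charCoeff u₂ (-χ)‖ - ‖charCoeff u₃ (-χ)‖)]
    _ = ‖charCoeff u₁ χ₀‖ *
        ((∑ χ, ‖charCoeff u₂ (-χ)‖ ^ 2 + ∑ χ, ‖charCoeff u₃ (-χ)‖ ^ 2) / 2) := by
        rw [← mul_sum, ← sum_div, sum_add_distrib]
    _ ≤ ‖charCoeff u₁ χ₀‖ * 1 := by
        gcongr
        linarith [hneg u₂ h₂, hneg u₃ h₃]
    _ = _ := mul_one _

theorem exists_sum_norm_charCoeff_pow_four_le {u : G → ℂ} (hu : ∀ x, ‖u x‖ ≤ 1) :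
    ∃ χ, ∑ ψ, ‖charCoeff u ψ‖ ^ 4 ≤ ‖charCoeff u χ‖ ^ 2 := by
  obtain ⟨χ, hχ⟩ := Finite.exists_max fun χ => ‖charCoeff u χ‖
  refine ⟨χ, ?_⟩
  calc ∑ ψ, ‖charCoeff u ψ‖ ^ 4 = ∑ ψ, ‖charCoeff u ψ‖ ^ 2 * ‖charCoeff u ψ‖ ^ 2 :=
        sum_congr rfl fun ψ _ => by ring
    _ ≤ ∑ ψ, ‖charCoeff u χ‖ ^ 2 * ‖charCoeff u ψ‖ ^ 2 := by
        gcongr with ψ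
        exact hχ ψ
    _ = ‖charCoeff u χ‖ ^ 2 * ∑ ψ, ‖charCoeff u ψ‖ ^ 2 := (mul_sum _ _ _).symm
    _ ≤ ‖charCoeff u χ‖ ^ 2 :=
        mul_le_of_le_one_right (sq_nonneg _) (sum_norm_charCoeff_sq_le_one hu)

theorem expect_apply_mul_conj_apply [DecidableEq (AddChar G ℂ)] (χ ψ : AddChar G ℂ) :
    𝔼 x, χ x * conj (ψ x) = if ψ = χ then 1 else 0 := by
  simp_rw [← AddChar.map_neg_eq_conj, AddChar.map_neg_eq_inv, ← div_eq_mul_inv,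
    ← AddChar.sub_apply', AddChar.expect_eq_ite, sub_eq_zero, eq_comm]

/-- The form of Parseval in which the characters `ψ h` carry weights `a h` and may coincide. -/
theorem expect_norm_sq_expect_mul_addChar [DecidableEq (AddChar G ℂ)] {ι : Type*} [Fintype ι]
    (a : ι → ℝ) (ψ : ι → AddChar G ℂ) :
    𝔼 k, ‖𝔼 h, (a h : ℂ) * ψ h k‖ ^ 2 =
      (∑ χ, (∑ h with ψ h = χ, a h) ^ 2) / (Fintype.card ι : ℝ) ^ 2 := by
  have hleft : 𝔼 k, ‖𝔼 h, (a h : ℂ) * ψ h k‖ ^ 2 =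
      𝔼 h, 𝔼 h', if ψ h' = ψ h then a h * a h' else 0 := by
    apply Complex.ofReal_injective
    simp only [Complex.ofReal_expect, ofReal_norm_expect_sq]
    rw [expect_comm]
    refine expect_congr rfl fun h _ => ?_
    rw [expect_comm]
    refine expect_congr rfl fun h' _ => ?_
    simp_rw [map_mul, Complex.conj_ofReal, mul_mul_mul_comm, ← mul_expect,
      expect_apply_mul_conj_apply]
    split_ifs <;> simp
  have hright : ∑ χ, (∑ h with ψ h = χ, a h) ^ 2 =
      ∑ h, ∑ h', if ψ h' = ψ h then a h * a h' else 0 := by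
    rw [← sum_fiberwise univ ψ]
    refine sum_congr rfl fun χ _ => ?_
    rw [sq, sum_mul_sum]
    refine sum_congr rfl fun h hh => ?_
    rw [(mem_filter.1 hh).2, sum_filter]
  rw [hleft, hright]
  simp only [Fintype.expect_eq_sum_div_card, ← sum_div, div_div, ← sq]

end Fourier

section BalogSzemerediGowers

open Finset
open scoped Pointwise Combinatorics.Additive

variable {G : Type*} [AddCommGroup G] [DecidableEq G]

theorem sum_addConvolution_neg_self (A : Finset G) :
    ∑ x ∈ A - A, A.addConvolution (-A) x = #A ^ 2 := by
  simp only [← card_sub_eq]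
  rw [sum_card_fiberwise_eq_card_filter, filter_true_of_mem, card_product, sq]
  exact fun p hp => sub_mem_sub (mem_product.1 hp).1 (mem_product.1 hp).2

theorem addEnergy_self_eq_sum_addConvolution_neg_sq (A : Finset G) :
    E[A] = ∑ x ∈ A - A, A.addConvolution (-A) x ^ 2 := by
  set quads := {s ∈ (A ×ˢ A) ×ˢ (A ×ˢ A) | s.1.1 - s.1.2 = s.2.1 - s.2.2}
  have hquads : E[A] = #quads := by
    refine card_equiv ((Equiv.refl _).prodCongr (Equiv.prodComm _ _)) fun s => ?_
    simp only [quads, mem_filter, mem_product, Equiv.prodCongr_apply, Prod.map_fst,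
      Prod.map_snd, Equiv.refl_apply, Equiv.prodComm_apply, Prod.fst_swap, Prod.snd_swap,
      sub_eq_sub_iff_add_eq_add, and_comm (a := s.2.1 ∈ A), add_comm s.2.2 s.1.2]
  rw [hquads, card_eq_sum_card_fiberwise (f := fun s => s.1.1 - s.1.2) (t := A - A)]
  · refine sum_congr rfl fun x _ => ?_
    rw [sq, ← card_sub_eq, ← card_product]
    congr 1
    ext s
    simp only [quads, mem_filter, mem_product]
    grind
  · intro s hs
    simp only [quads, coe_filter, mem_product] at hs
    exact sub_mem_sub hs.1.1.1 hs.1.1.2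

theorem card_filter_sub_mem_sub_mem_le (S A : Finset G) (a b : G) :
    #{x ∈ S | a - x ∈ A ∧ b - x ∈ A} ≤ A.addConvolution (-A) (a - b) := by
  rw [← card_sub_eq]
  refine card_le_card_of_injOn (fun x => (a - x, b - x)) (fun x hx => ?_) fun x _ y _ h => ?_
  · simpa using (mem_filter.1 hx).2
  · exact sub_right_injective (congrArg Prod.fst h)

theorem sum_card_filter_addConvolution_le (A : Finset G) {t : ℝ} (ht : 0 ≤ t) :
    ∑ x ∈ A - A, (#{p ∈ (A ∩ (x +ᵥ A)) ×ˢ (A ∩ (x +ᵥ A)) |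
      (A.addConvolution (-A) (p.1 - p.2) : ℝ) ≤ t} : ℝ) ≤ #A ^ 2 * t := by
  set unpopular := {p ∈ A ×ˢ A | (A.addConvolution (-A) (p.1 - p.2) : ℝ) ≤ t}
  calc _ = ∑ x ∈ A - A, ∑ p ∈ unpopular, if p.1 - x ∈ A ∧ p.2 - x ∈ A then (1 : ℝ) else 0 := by
        refine sum_congr rfl fun x _ => ?_
        rw [sum_boole, filter_filter]
        congr 2
        ext p
        simp only [mem_filter, mem_product, mem_inter, ← neg_vadd_mem_iff, vadd_eq_add,
          neg_add_eq_sub]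
        tauto
    _ = ∑ p ∈ unpopular, (#{x ∈ A - A | p.1 - x ∈ A ∧ p.2 - x ∈ A} : ℝ) := by
        rw [sum_comm]
        simp only [sum_boole]
    _ ≤ ∑ _p ∈ unpopular, t := sum_le_sum fun p hp =>
        (Nat.cast_le.2 (card_filter_sub_mem_sub_mem_le _ _ _ _)).trans (mem_filter.1 hp).2
    _ ≤ #A ^ 2 * t := by
        rw [sum_const, nsmul_eq_mul]
        gcongr
        exact_mod_cast (card_filter_le _ _).trans_eq (by rw [card_product, sq])

/-- The dense subset is the intersection of `A` with a random translate `x + A`: a pair of elements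
of `A` survives with probability proportional to its number of differences, so unpopular pairs
rarely do. -/
theorem exists_subset_few_unpopular_pairs {A : Finset G} (hA : A.Nonempty) {κ : ℝ} (hκ : 0 < κ)
    (h : κ * (#A : ℝ) ^ 3 ≤ E[A]) :
    ∃ X ⊆ A, X.Nonempty ∧ κ / 2 * #A ≤ #X ∧
      8 * (#{p ∈ X ×ˢ X | (A.addConvolution (-A) (p.1 - p.2) : ℝ) ≤ κ / 16 * #A} : ℝ) ≤
        (#X : ℝ) ^ 2 := by
  set bad : G → ℝ := fun x => #{p ∈ (A ∩ (x +ᵥ A)) ×ˢ (A ∩ (x +ᵥ A)) |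
    (A.addConvolution (-A) (p.1 - p.2) : ℝ) ≤ κ / 16 * #A}
  set r : G → ℝ := fun x => A.addConvolution (-A) x
  have : (0 : ℝ) < #A := by exact_mod_cast hA.card_pos
  have hbad : ∑ x ∈ A - A, bad x ≤ #A ^ 2 * (κ / 16 * #A) :=
    sum_card_filter_addConvolution_le A (by positivity)
  have hr : ∑ x ∈ A - A, r x = (#A : ℝ) ^ 2 := by
    simp only [r, ← Nat.cast_sum, sum_addConvolution_neg_self, Nat.cast_pow]
  have hr2 : (E[A] : ℝ) = ∑ x ∈ A - A, r x ^ 2 := by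
    simp only [r, addEnergy_self_eq_sum_addConvolution_neg_sq, Nat.cast_sum, Nat.cast_pow]
  obtain ⟨x, hx, hle⟩ : ∃ x ∈ A - A, κ / 2 * #A * r x ≤ r x ^ 2 - 8 * bad x := by
    refine exists_le_of_sum_le (hA.sub hA) ?_
    rw [sum_sub_distrib, ← mul_sum, ← mul_sum, hr, ← hr2]
    linarith
  have hrx : 0 < r x := by
    rw [sub_eq_add_neg, ← addConvolution_pos] at hx
    exact Nat.cast_pos.2 hx
  have hcard : (#(A ∩ (x +ᵥ A)) : ℝ) = r x := by rw [card_inter_vadd]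
  have hbadx : 0 ≤ bad x := Nat.cast_nonneg _
  refine ⟨A ∩ (x +ᵥ A), inter_subset_left, card_pos.1 ?_, ?_, ?_⟩
  · exact_mod_cast hcard ▸ hrx
  · rw [hcard]
    nlinarith
  · rw [hcard]
    have : 0 ≤ κ / 2 * #A * r x := by positivity
    linarith

theorem exists_half_subset_forall_few_related {α : Type*} (X : Finset α) (r : α → α → Prop)
    [DecidableRel r] (h : 8 * #{p ∈ X ×ˢ X | r p.1 p.2} ≤ #X ^ 2) :
    ∃ Y ⊆ X, #X ≤ 2 * #Y ∧ ∀ a ∈ Y, 4 * #{b ∈ X | r a b} ≤ #X := by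
  classical
  set Y := {a ∈ X | 4 * #{b ∈ X | r a b} ≤ #X}
  refine ⟨Y, filter_subset _ _, ?_, fun a ha => (mem_filter.1 ha).2⟩
  have hpairs : #{p ∈ X ×ˢ X | r p.1 p.2} = ∑ a ∈ X, #{b ∈ X | r a b} := by
    simp only [card_filter, sum_product]
  have hcompl : #(X \ Y) * #X ≤ 4 * #{p ∈ X ×ˢ X | r p.1 p.2} := by
    rw [hpairs, mul_sum, ← smul_eq_mul, ← sum_const]
    refine (sum_le_sum fun a ha => ?_).trans (sum_le_sum_of_subset sdiff_subset)
    simp only [Y, mem_sdiff, mem_filter, not_and, not_le] at ha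
    exact (ha.2 ha.1).le
  have hsplit : #(X \ Y) + #Y = #X := card_sdiff_add_card_eq_card (filter_subset _ _)
  rcases Nat.eq_zero_or_pos #X with h0 | h0
  · omega
  · nlinarith

theorem card_le_two_mul_card_filter_not {α : Type*} {X : Finset α} {p q : α → Prop}
    [DecidablePred p] [DecidablePred q] (hp : 4 * #{c ∈ X | p c} ≤ #X)
    (hq : 4 * #{c ∈ X | q c} ≤ #X) : #X ≤ 2 * #{c ∈ X | ¬ p c ∧ ¬ q c} := by
  classical
  have hcover : X ⊆ {c ∈ X | ¬ p c ∧ ¬ q c} ∪ ({c ∈ X | p c} ∪ {c ∈ X | q c}) := by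
    intro c hc
    simp only [mem_union, mem_filter]
    tauto
  have := (card_le_card hcover).trans (card_union_le _ _)
  have := card_union_le {c ∈ X | p c} {c ∈ X | q c}
  omega

/-- Each `c ∈ C` gives `t²` representations `a - b = (a - c) - (b - c)`. -/
theorem card_mul_sq_le_card_filter_sub_sub {A C : Finset G} {t : ℝ} (ht : 0 ≤ t) {a b : G}
    (ha : ∀ c ∈ C, t ≤ A.addConvolution (-A) (a - c))
    (hb : ∀ c ∈ C, t ≤ A.addConvolution (-A) (b - c)) :
    #C * t ^ 2 ≤ (#{s ∈ (A ×ˢ A) ×ˢ (A ×ˢ A) |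
      (s.1.1 - s.1.2) - (s.2.1 - s.2.2) = a - b} : ℝ) := by
  set reps := {s ∈ (A ×ˢ A) ×ˢ (A ×ˢ A) | (s.1.1 - s.1.2) - (s.2.1 - s.2.2) = a - b}
  have hfiber : ∀ c ∈ C, t ^ 2 ≤ (#{s ∈ reps | a - (s.1.1 - s.1.2) = c} : ℝ) := by
    intro c hc
    have hsub : {p ∈ A ×ˢ A | p.1 - p.2 = a - c} ×ˢ {p ∈ A ×ˢ A | p.1 - p.2 = b - c} ⊆
        {s ∈ reps | a - (s.1.1 - s.1.2) = c} := by
      rintro ⟨p, q⟩ hpq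
      simp only [reps, mem_product, mem_filter] at hpq ⊢
      obtain ⟨⟨hpA, hp⟩, hqA, hq⟩ := hpq
      refine ⟨⟨⟨hpA, hqA⟩, ?_⟩, ?_⟩
      · rw [hp, hq]
        abel
      · rw [hp]
        abel
    have hle := card_le_card hsub
    rw [card_product, card_sub_eq, card_sub_eq] at hle
    calc t ^ 2 ≤ (A.addConvolution (-A) (a - c) : ℝ) * A.addConvolution (-A) (b - c) := by
          rw [sq]
          exact mul_le_mul (ha c hc) (hb c hc) ht (Nat.cast_nonneg _)
      _ ≤ _ := by exact_mod_cast hle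
  calc #C * t ^ 2 = ∑ _c ∈ C, t ^ 2 := by rw [sum_const, nsmul_eq_mul]
    _ ≤ ∑ c ∈ C, (#{s ∈ reps | a - (s.1.1 - s.1.2) = c} : ℝ) := sum_le_sum hfiber
    _ ≤ #reps := by
        rw [← Nat.cast_sum, sum_card_fiberwise_eq_card_filter]
        exact_mod_cast card_filter_le _ _

theorem half_card_mul_sq_le_card_filter_sub_sub {A X : Finset G} {t : ℝ} (ht : 0 ≤ t) {a b : G}
    (ha : 4 * #{c ∈ X | (A.addConvolution (-A) (a - c) : ℝ) ≤ t} ≤ #X)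
    (hb : 4 * #{c ∈ X | (A.addConvolution (-A) (b - c) : ℝ) ≤ t} ≤ #X) :
    #X / 2 * t ^ 2 ≤ (#{s ∈ (A ×ˢ A) ×ˢ (A ×ˢ A) |
      (s.1.1 - s.1.2) - (s.2.1 - s.2.2) = a - b} : ℝ) := by
  have hC : (#X : ℝ) ≤ 2 * #{c ∈ X | ¬ (A.addConvolution (-A) (a - c) : ℝ) ≤ t ∧
      ¬ (A.addConvolution (-A) (b - c) : ℝ) ≤ t} := by
    exact_mod_cast card_le_two_mul_card_filter_not ha hb
  set C := {c ∈ X | ¬ (A.addConvolution (-A) (a - c) : ℝ) ≤ t ∧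
    ¬ (A.addConvolution (-A) (b - c) : ℝ) ≤ t}
  calc #X / 2 * t ^ 2 ≤ #C * t ^ 2 := by
        gcongr
        linarith
    _ ≤ _ := card_mul_sq_le_card_filter_sub_sub ht
        (fun c hc => (not_le.1 (mem_filter.1 hc).2.1).le)
        (fun c hc => (not_le.1 (mem_filter.1 hc).2.2).le)

theorem card_mul_le_card_pow_four {A D : Finset G} {m : ℝ}
    (h : ∀ d ∈ D, m ≤ (#{s ∈ (A ×ˢ A) ×ˢ (A ×ˢ A) |
      (s.1.1 - s.1.2) - (s.2.1 - s.2.2) = d} : ℝ)) : #D * m ≤ (#A : ℝ) ^ 4 := by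
  calc #D * m = ∑ _d ∈ D, m := by rw [sum_const, nsmul_eq_mul]
    _ ≤ _ := sum_le_sum h
    _ ≤ (#((A ×ˢ A) ×ˢ (A ×ˢ A)) : ℝ) := by
        rw [← Nat.cast_sum, sum_card_fiberwise_eq_card_filter]
        exact_mod_cast card_filter_le _ _
    _ = (#A : ℝ) ^ 4 := by
        rw [card_product, card_product]
        push_cast
        ring

theorem balog_szemeredi_gowers {A : Finset G} (hA : A.Nonempty) {κ : ℝ} (hκ : 0 < κ)
    (h : κ * (#A : ℝ) ^ 3 ≤ E[A]) :
    ∃ B ⊆ A, B.Nonempty ∧ κ / 4 * #A ≤ #B ∧ (#(B - B) : ℝ) ≤ 4096 / κ ^ 4 * #B := by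
  classical
  have : (0 : ℝ) < #A := by exact_mod_cast hA.card_pos
  obtain ⟨X, hXA, hX, hXcard, hunpopular⟩ := exists_subset_few_unpopular_pairs hA hκ h
  set t := κ / 16 * #A with ht
  obtain ⟨B, hBX, hBcard, hB⟩ := exists_half_subset_forall_few_related X
    (fun a b => (A.addConvolution (-A) (a - b) : ℝ) ≤ t) (by exact_mod_cast hunpopular)
  have hBcard' : (#X : ℝ) ≤ 2 * #B := by exact_mod_cast hBcard
  have hX0 : 0 < #X := hX.card_pos
  have hrep : ∀ d ∈ B - B, (#X / 2 * t ^ 2 : ℝ) ≤ (#{s ∈ (A ×ˢ A) ×ˢ (A ×ˢ A) |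
      (s.1.1 - s.1.2) - (s.2.1 - s.2.2) = d} : ℝ) := by
    intro d hd
    obtain ⟨a, ha, b, hb, rfl⟩ := mem_sub.1 hd
    exact half_card_mul_sq_le_card_filter_sub_sub (by positivity) (hB a ha) (hB b hb)
  have hmul : (#(B - B) : ℝ) * (κ ^ 3 / 1024) * #A ^ 3 ≤ #A * #A ^ 3 := by
    calc (#(B - B) : ℝ) * (κ ^ 3 / 1024) * #A ^ 3
        = #(B - B) * (κ / 2 * #A / 2 * t ^ 2) := by rw [ht]; ring
      _ ≤ #(B - B) * (#X / 2 * t ^ 2) := by gcongr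
      _ ≤ #A * #A ^ 3 := (card_mul_le_card_pow_four hrep).trans_eq (by ring)
  have hdiff : (#(B - B) : ℝ) * (κ ^ 3 / 1024) ≤ #A :=
    le_of_mul_le_mul_right hmul (by positivity)
  refine ⟨B, hBX.trans hXA, card_pos.1 (by omega), by linarith, ?_⟩
  rw [div_mul_eq_mul_div, le_div_iff₀ (by positivity)]
  nlinarith [mul_le_mul_of_nonneg_right hdiff hκ.le]

end BalogSzemerediGowers

section Freiman

open Finset
open scoped Pointwise

variable {p : ℕ} [Fact p.Prime]

section Module

variable {G : Type*} [AddCommGroup G] [Module (ZMod p) G]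

theorem coe_span_subset_of_subset_addSubmonoid {s : Set G} {N : AddSubmonoid G}
    (hs : s ⊆ N) : (Submodule.span (ZMod p) s : Set G) ⊆ N := by
  intro x hx
  induction hx using Submodule.span_induction with
  | mem x hx => exact hs hx
  | zero => exact N.zero_mem
  | add x y _ _ hx hy => exact N.add_mem hx hy
  | smul c x _ hx =>
    rw [← ZMod.natCast_zmod_val c, Nat.cast_smul_eq_nsmul]
    exact N.nsmul_mem hx _

theorem coe_span_subset_span_add_of_add_subset {F D : Set G} (h0 : 0 ∈ D)
    (hcover : D + D ⊆ F + D) :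
    (Submodule.span (ZMod p) D : Set G) ⊆ (Submodule.span (ZMod p) F : Set G) + D := by
  let N : AddSubmonoid G :=
    { carrier := (Submodule.span (ZMod p) F : Set G) + D
      zero_mem' := ⟨0, zero_mem _, 0, h0, add_zero 0⟩
      add_mem' := by
        rintro _ _ ⟨s, hs, d, hd, rfl⟩ ⟨s', hs', d', hd', rfl⟩
        obtain ⟨f, hf, e, he, hfe⟩ := hcover (Set.add_mem_add hd hd')
        refine ⟨s + s' + f, add_mem (add_mem hs hs') (Submodule.subset_span hf), e, he, ?_⟩
        simp only at hfe ⊢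
        rw [add_assoc (s + s'), hfe, add_add_add_comm] }
  exact coe_span_subset_of_subset_addSubmonoid (N := N)
    fun d hd => ⟨0, zero_mem _, d, hd, zero_add d⟩

theorem card_span_finset_le_pow (F : Finset G) :
    Nat.card (Submodule.span (ZMod p) (F : Set G)) ≤ p ^ #F := by
  rw [Module.natCard_eq_pow_finrank (K := ZMod p), Nat.card_zmod]
  exact Nat.pow_le_pow_right (Fact.out : p.Prime).pos (finrank_span_finset_le_card F)

end Module

theorem exists_finset_sub_add_sub_subset_add {G : Type*} [AddCommGroup G] [DecidableEq G]
    {A : Finset G} (hA : A.Nonempty) {K : ℕ} (hK : #(A - A) ≤ K * #A) :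
    ∃ F : Finset G, #F ≤ K ^ 5 ∧ (A - A) + (A - A) ⊆ F + (A - A) := by
  have hset : (A - A) + (A - A) + A = 3 • A - 2 • A := by
    simp only [sub_eq_add_neg, succ_nsmul, zero_nsmul, neg_add, zero_add]
    generalize -A = B
    abel
  have hsmall : (#((A - A) + (A - A) + A) : ℝ) ≤ (K ^ 5 : ℕ) * #A := by
    have hdoubling : (#(A - A) : ℚ≥0) / #A ≤ K := by
      rw [div_le_iff₀ (by exact_mod_cast hA.card_pos)]
      exact_mod_cast hK
    have hruzsa : (#(3 • A - 2 • A) : ℚ≥0) ≤ (K : ℚ≥0) ^ 5 * #A :=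
      (pluennecke_ruzsa_inequality_nsmul_sub_nsmul_sub hA A 3 2).trans (by gcongr)
    rw [hset]
    exact_mod_cast hruzsa
  obtain ⟨F, -, hFcard, hcover⟩ := ruzsa_covering_add hA hsmall
  exact ⟨F, by exact_mod_cast hFcard, hcover⟩

theorem card_span_sub_le_of_card_sub_le {G : Type*} [AddCommGroup G] [DecidableEq G]
    [Module (ZMod p) G] [Finite G] {A : Finset G} (hA : A.Nonempty) {K : ℕ}
    (hK : #(A - A) ≤ K * #A) :
    Nat.card (Submodule.span (ZMod p) ((A - A : Finset G) : Set G)) ≤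
      p ^ K ^ 5 * K * #A := by
  obtain ⟨F, hFcard, hcover⟩ := exists_finset_sub_add_sub_subset_add hA hK
  have hsub : (Submodule.span (ZMod p) ((A - A : Finset G) : Set G) : Set G) ⊆
      (Submodule.span (ZMod p) (F : Set G) : Set G) + ((A - A : Finset G) : Set G) := by
    refine coe_span_subset_span_add_of_add_subset ?_ (by exact_mod_cast hcover)
    exact_mod_cast zero_mem_sub_iff.2 (by simpa using hA.ne_empty)
  calc _ ≤ ((Submodule.span (ZMod p) (F : Set G) : Set G) +
        ((A - A : Finset G) : Set G)).ncard := Set.ncard_le_ncard hsub (Set.toFinite _)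
    _ ≤ Nat.card (Submodule.span (ZMod p) (F : Set G)) * #(A - A) := by
        rw [← Set.ncard_coe_finset]
        exact Set.natCard_add_le
    _ ≤ p ^ K ^ 5 * (K * #A) := by
        gcongr
        exact (card_span_finset_le_pow F).trans
          (Nat.pow_le_pow_right (Fact.out : p.Prime).pos hFcard)
    _ = _ := (mul_assoc _ _ _).symm

theorem exists_linearMap_prodMk_mem {𝕜 V W : Type*} [Field 𝕜] [AddCommGroup V] [Module 𝕜 V]
    [AddCommGroup W] [Module 𝕜 W] (U : Submodule 𝕜 (V × W)) :
    ∃ L : V →ₗ[𝕜] W, ∀ z ∈ U, (z.1, L z.1) ∈ U := by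
  set π : U →ₗ[𝕜] V := LinearMap.fst 𝕜 V W ∘ₗ U.subtype
  obtain ⟨s, hs⟩ := π.rangeRestrict.exists_rightInverse_of_surjective π.range_rangeRestrict
  obtain ⟨L, hL⟩ := LinearMap.exists_extend (LinearMap.snd 𝕜 V W ∘ₗ U.subtype ∘ₗ s)
  refine ⟨L, fun z hz => ?_⟩
  let x : LinearMap.range π := ⟨z.1, ⟨z, hz⟩, rfl⟩
  have hfst : (s x : V × W).1 = z.1 := congrArg Subtype.val (LinearMap.congr_fun hs x)
  have hsnd : L z.1 = (s x : V × W).2 := LinearMap.congr_fun hL x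
  rw [hsnd, ← hfst]
  exact (s x).2

variable {V W : Type*} [AddCommGroup V] [Module (ZMod p) V] [Finite V]
  [AddCommGroup W] [Module (ZMod p) W] [Finite W]

theorem card_comap_inr_mul_card_le {U : Submodule (ZMod p) (V × W)} {H : Finset V} {ξ : V → W}
    {z : V × W} (hU : ∀ h ∈ H, (h, ξ h) - z ∈ U) :
    Nat.card (U.comap (LinearMap.inr (ZMod p) V W)) * #H ≤ Nat.card U := by
  rw [← Nat.card_eq_finsetCard, ← Nat.card_prod]
  refine Nat.card_le_card_of_injective
    (fun q : U.comap (LinearMap.inr (ZMod p) V W) × H =>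
      (⟨(0, (q.1 : W)) + ((q.2 : V), ξ q.2) - z, ?_⟩ : U)) ?_
  · rw [add_sub_assoc]
    exact U.add_mem q.1.2 (hU _ q.2.2)
  · rintro ⟨⟨v, _⟩, ⟨h, _⟩⟩ ⟨⟨v', _⟩, ⟨h', _⟩⟩ heq
    simp only [Subtype.mk.injEq, sub_left_inj, Prod.mk_add_mk, zero_add, Prod.mk.injEq] at heq
    obtain ⟨rfl, hv⟩ := heq
    simpa using hv

theorem exists_affine_eq_of_graph_card_sub_le [DecidableEq V] [DecidableEq W] {H : Finset V}
    (hH : H.Nonempty) (ξ : V → W) {K : ℕ}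
    (hK : #(H.image (fun h => (h, ξ h)) - H.image (fun h => (h, ξ h))) ≤ K * #H) :
    ∃ (L : V →ₗ[ZMod p] W) (b : W), #H ≤ p ^ K ^ 5 * K * #{h ∈ H | ξ h = L h + b} := by
  set Γ := H.image fun h => (h, ξ h)
  have hΓ : #Γ = #H := card_image_of_injective _ fun _ _ h => congrArg Prod.fst h
  set U := Submodule.span (ZMod p) ((Γ - Γ : Finset (V × W)) : Set (V × W))
  have hUcard : Nat.card U ≤ p ^ K ^ 5 * K * #H := by
    rw [← hΓ] at hK ⊢
    exact card_span_sub_le_of_card_sub_le (hH.image _) hK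
  obtain ⟨h₀, hh₀⟩ := hH
  have hU : ∀ h ∈ H, (h, ξ h) - (h₀, ξ h₀) ∈ U := fun h hh => Submodule.subset_span <|
    mem_coe.2 <| sub_mem_sub (mem_image_of_mem _ hh) (mem_image_of_mem _ hh₀)
  obtain ⟨L, hL⟩ := exists_linearMap_prodMk_mem U
  set T : Finset W := (Set.toFinite (U.comap (LinearMap.inr (ZMod p) V W) : Set W)).toFinset
  have hT : #T ≤ p ^ K ^ 5 * K := by
    refine Nat.le_of_mul_le_mul_right (le_trans ?_ hUcard) (card_pos.2 ⟨h₀, hh₀⟩)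
    rw [← Set.ncard_eq_toFinset_card]
    exact card_comap_inr_mul_card_le hU
  set β : V → W := fun h => ξ h - L h - (ξ h₀ - L h₀)
  have hβ : ∀ h ∈ H, β h ∈ T := by
    intro h hh
    have := U.sub_mem (hU h hh) (hL _ (hU h hh))
    simp only [Prod.mk_sub_mk, sub_self, map_sub] at this
    simpa [T, β, sub_sub_sub_comm] using this
  obtain ⟨v, -, hv⟩ := exists_max_image T (fun v => #{h ∈ H | β h = v}) ⟨_, hβ h₀ hh₀⟩
  have hfilter : {h ∈ H | ξ h = L h + (v + (ξ h₀ - L h₀))} = {h ∈ H | β h = v} :=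
    filter_congr fun h _ => by rw [sub_eq_iff_eq_add, sub_eq_iff_eq_add']
  refine ⟨L, v + (ξ h₀ - L h₀), ?_⟩
  rw [hfilter, mul_comm]
  exact (card_le_mul_card_image_of_maps_to hβ _ hv).trans (Nat.mul_le_mul_left _ hT)

/-- The loss of Freiman's theorem over `𝔽_p`, applied to the set which the
Balog–Szemerédi–Gowers theorem extracts from a set of normalised additive energy `κ`. -/
noncomputable def freimanLoss (p : ℕ) (κ : ℝ) : ℕ :=
  p ^ ⌈4096 / κ ^ 4⌉₊ ^ 5 * ⌈4096 / κ ^ 4⌉₊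

theorem freimanLoss_pos {κ : ℝ} (hκ : 0 < κ) : 0 < freimanLoss p κ :=
  Nat.mul_pos (pow_pos (Fact.out : p.Prime).pos _) (Nat.ceil_pos.2 (by positivity))

open scoped Combinatorics.Additive in
theorem exists_affine_eq_of_le_addEnergy_graph [DecidableEq V] [DecidableEq W] {H : Finset V}
    (hH : H.Nonempty) (ξ : V → W) {κ : ℝ} (hκ : 0 < κ)
    (h : κ * (#H : ℝ) ^ 3 ≤ E[H.image fun h => (h, ξ h)]) :
    ∃ (L : V →ₗ[ZMod p] W) (b : W),
      κ / 4 * #H ≤ freimanLoss p κ * (#{h ∈ H | ξ h = L h + b} : ℝ) := by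
  have hinj : Function.Injective fun h => (h, ξ h) := fun _ _ h => congrArg Prod.fst h
  rw [← card_image_of_injective H hinj] at h
  obtain ⟨B, hB, hB0, hBcard, hBdoubling⟩ := balog_szemeredi_gowers (hH.image _) hκ h
  obtain ⟨H', hH', rfl⟩ := subset_image_iff.1 hB
  rw [card_image_of_injective _ hinj] at hBcard hBdoubling
  rw [card_image_of_injective _ hinj] at hBcard
  obtain ⟨L, b, hLb⟩ := exists_affine_eq_of_graph_card_sub_le (p := p) (image_nonempty.1 hB0) ξ
    (K := ⌈4096 / κ ^ 4⌉₊) <| by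
      have : (4096 / κ ^ 4 * #H' : ℝ) ≤ ⌈4096 / κ ^ 4⌉₊ * #H' := by
        gcongr
        exact Nat.le_ceil _
      exact_mod_cast hBdoubling.trans this
  refine ⟨L, b, hBcard.trans ?_⟩
  calc (#H' : ℝ) ≤ freimanLoss p κ * (#{h ∈ H' | ξ h = L h + b} : ℝ) := by
        exact_mod_cast hLb
    _ ≤ _ := by gcongr

end Freiman

section Derivatives

open Finset ComplexConjugate
open scoped Combinatorics.Additive Pointwise

variable {G : Type*} [AddCommGroup G]

/-- The multiplicative derivative of `f` in the direction `h`. -/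
def mulDeriv (f : G → ℂ) (h x : G) : ℂ := conj (f x) * f (x + h)

theorem norm_mulDeriv_le_one {f : G → ℂ} (hf : ∀ x, ‖f x‖ ≤ 1) (h x : G) :
    ‖mulDeriv f h x‖ ≤ 1 :=
  norm_mul_le_one ((RCLike.norm_conj _).trans_le (hf x)) (hf _)

theorem mulDeriv_mulDeriv_comm (f : G → ℂ) (h k x : G) :
    mulDeriv (mulDeriv f h) k x = mulDeriv (mulDeriv f k) h x := by
  simp only [mulDeriv, map_mul, add_right_comm x k h]
  ring

theorem mulDeriv_mul_addChar [Finite G] (u : G → ℂ) (χ : AddChar G ℂ) (k x : G) :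
    mulDeriv (fun y => u y * χ y) k x = mulDeriv u k x * χ k := by
  have hχ : conj (χ x) * χ (x + k) = χ k := by
    rw [← AddChar.map_neg_eq_conj, ← AddChar.map_add_eq_mul, neg_add_cancel_left]
  simp only [mulDeriv, map_mul, ← hχ]
  ring

variable [Fintype G]

theorem ofReal_norm_expect_sq_eq_mulDeriv (g : G → ℂ) :
    ((‖𝔼 x, g x‖ ^ 2 : ℝ) : ℂ) = 𝔼 k, 𝔼 x, mulDeriv g k x := by
  rw [← Complex.norm_conj, map_expect, ofReal_norm_expect_sq, expect_comm univ univ (mulDeriv g)]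
  refine expect_congr rfl fun x _ => ?_
  simp only [Complex.conj_conj]
  exact expect_eq_expect_add_left x _

theorem ofReal_norm_charCoeff_sq (u : G → ℂ) (χ : AddChar G ℂ) :
    ((‖charCoeff u χ‖ ^ 2 : ℝ) : ℂ) = 𝔼 k, 𝔼 x, mulDeriv u k x * χ k := by
  simp only [charCoeff, ofReal_norm_expect_sq_eq_mulDeriv, mulDeriv_mul_addChar]

theorem expect_norm_expect_mulDeriv_sq (u : G → ℂ) :
    𝔼 k, ‖𝔼 x, mulDeriv u k x‖ ^ 2 = ∑ χ, ‖charCoeff u χ‖ ^ 4 := by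
  rw [← sum_norm_charCoeff_sq]
  refine sum_congr rfl fun χ _ => ?_
  have hcoeff : charCoeff (fun k => 𝔼 x, mulDeriv u k x) χ = ((‖charCoeff u χ‖ ^ 2 : ℝ) : ℂ) := by
    simp only [ofReal_norm_charCoeff_sq, ← expect_mul]
    rfl
  rw [hcoeff, sq_norm_ofReal, ← pow_mul]

/-- The eighth power of the Gowers `U³`-norm of `f`, written as the average over the directions
`h` of the fourth power of the `U²`-norm of the derivative of `f` in the direction `h`. -/
noncomputable def gowersU3Energy (f : G → ℂ) : ℝ :=
  𝔼 h, 𝔼 k, ‖𝔼 x, mulDeriv (mulDeriv f h) k x‖ ^ 2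

theorem exists_gowersU3Energy_le_expect_norm_charCoeff {f : G → ℂ} (hf : ∀ x, ‖f x‖ ≤ 1) :
    ∃ χ : G → AddChar G ℂ, gowersU3Energy f ≤ 𝔼 h, ‖charCoeff (mulDeriv f h) (χ h)‖ ^ 2 := by
  choose χ hχ using fun h => exists_sum_norm_charCoeff_pow_four_le (norm_mulDeriv_le_one hf h)
  refine ⟨χ, expect_le_expect fun h _ => ?_⟩
  rw [expect_norm_expect_mulDeriv_sq]
  exact hχ h

section WeightedCoefficients

variable (f : G → ℂ) (w : G → ℝ) (χ : G → AddChar G ℂ)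

theorem ofReal_expect_mul_norm_charCoeff_sq :
    ((𝔼 h, w h * ‖charCoeff (mulDeriv f h) (χ h)‖ ^ 2 : ℝ) : ℂ) =
      𝔼 k, 𝔼 x, conj (mulDeriv f k x) * 𝔼 h, w h * χ h k * mulDeriv f k (x + h) := by
  simp only [Complex.ofReal_expect, Complex.ofReal_mul, ofReal_norm_charCoeff_sq, mul_expect]
  rw [expect_comm]
  refine expect_congr rfl fun k _ => ?_
  rw [expect_comm]
  refine expect_congr rfl fun x _ => expect_congr rfl fun h _ => ?_
  rw [mulDeriv_mulDeriv_comm, mulDeriv]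
  ring

theorem ofReal_expect_norm_sq_expect_mulDeriv :
    ((𝔼 k, 𝔼 x, ‖𝔼 h, w h * χ h k * mulDeriv f k (x + h)‖ ^ 2 : ℝ) : ℂ) =
      𝔼 k, 𝔼 d, (𝔼 x, mulDeriv (mulDeriv f k) d x) *
        𝔼 h, ((w h * w (h + d) : ℝ) : ℂ) * (χ (h + d) - χ h) k := by
  simp only [Complex.ofReal_expect, ofReal_norm_expect_sq_eq_mulDeriv]
  refine expect_congr rfl fun k _ => ?_
  rw [expect_comm]
  refine expect_congr rfl fun d _ => ?_
  rw [expect_comm, mul_expect]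
  refine expect_congr rfl fun h _ => ?_
  rw [expect_eq_expect_add_left h (mulDeriv (mulDeriv f k) d), expect_mul]
  refine expect_congr rfl fun x _ => ?_
  rw [sub_eq_add_neg, AddChar.add_apply, AddChar.neg_apply, AddChar.map_neg_eq_conj]
  simp only [mulDeriv, map_mul, Complex.conj_ofReal, Complex.ofReal_mul, add_comm h x, add_assoc]
  ring

variable {f}

theorem expect_mul_norm_charCoeff_sq_sq_le (hf : ∀ x, ‖f x‖ ≤ 1) :
    (𝔼 h, w h * ‖charCoeff (mulDeriv f h) (χ h)‖ ^ 2) ^ 2 ≤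
      𝔼 k, 𝔼 x, ‖𝔼 h, w h * χ h k * mulDeriv f k (x + h)‖ ^ 2 := by
  rw [← sq_norm_ofReal, ofReal_expect_mul_norm_charCoeff_sq]
  exact norm_expect_expect_mul_sq_le fun k x =>
    (RCLike.norm_conj _).trans_le (norm_mulDeriv_le_one hf k x)

/-- After a second application of the Cauchy–Schwarz inequality `f` has disappeared altogether. -/
theorem expect_mul_norm_charCoeff_sq_pow_four_le (hf : ∀ x, ‖f x‖ ≤ 1) :
    (𝔼 h, w h * ‖charCoeff (mulDeriv f h) (χ h)‖ ^ 2) ^ 4 ≤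
      𝔼 d, 𝔼 k, ‖𝔼 h, ((w h * w (h + d) : ℝ) : ℂ) * (χ (h + d) - χ h) k‖ ^ 2 := by
  calc _ = ((𝔼 h, w h * ‖charCoeff (mulDeriv f h) (χ h)‖ ^ 2) ^ 2) ^ 2 := by ring
    _ ≤ (𝔼 k, 𝔼 x, ‖𝔼 h, w h * χ h k * mulDeriv f k (x + h)‖ ^ 2) ^ 2 := by
        gcongr
        exact expect_mul_norm_charCoeff_sq_sq_le w χ hf
    _ ≤ 𝔼 k, 𝔼 d, ‖𝔼 h, ((w h * w (h + d) : ℝ) : ℂ) * (χ (h + d) - χ h) k‖ ^ 2 := by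
        rw [← sq_norm_ofReal, ofReal_expect_norm_sq_expect_mulDeriv]
        exact norm_expect_expect_mul_sq_le fun k d =>
          norm_expect_le_one (norm_mulDeriv_le_one (norm_mulDeriv_le_one hf k) d)
    _ = _ := expect_comm _ _ _

end WeightedCoefficients

theorem addConvolution_neg_image_graph {W : Type*} [AddCommGroup W] [DecidableEq G]
    [DecidableEq W] (H : Finset G) (ξ : G → W) (d : G) (e : W) :
    (H.image fun h => (h, ξ h)).addConvolution (-H.image fun h => (h, ξ h)) (d, e) =
      #{h | ξ (h + d) - ξ h = e ∧ h ∈ H ∧ h + d ∈ H} := by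
  rw [← card_sub_eq]
  symm
  refine card_bij (fun h _ => ((h + d, ξ (h + d)), (h, ξ h))) (fun h hh => ?_)
    (fun _ _ _ _ h => congrArg (fun q => q.2.1) h) fun q hq => ?_
  · obtain ⟨hsub, hh, hhd⟩ := (mem_filter.1 hh).2
    simp only [mem_filter, mem_product, mem_image, Prod.mk_sub_mk, add_sub_cancel_left, hsub,
      and_true]
    exact ⟨⟨_, hhd, rfl⟩, _, hh, rfl⟩
  · obtain ⟨hq, hsub⟩ := mem_filter.1 hq
    obtain ⟨p, r⟩ := q
    obtain ⟨hp, hr⟩ := mem_product.1 hq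
    obtain ⟨a, ha, rfl⟩ := mem_image.1 hp
    obtain ⟨b, hb, rfl⟩ := mem_image.1 hr
    obtain ⟨rfl, rfl⟩ := Prod.mk.inj hsub
    exact ⟨b, by simp [ha, hb], by simp⟩

theorem sum_addConvolution_neg_sq (A : Finset G) [DecidableEq G] :
    ∑ x, A.addConvolution (-A) x ^ 2 = E[A] := by
  rw [addEnergy_self_eq_sum_addConvolution_neg_sq]
  refine (sum_subset (subset_univ _) fun x _ hx => ?_).symm
  rw [sub_eq_add_neg, ← addConvolution_eq_zero] at hx
  rw [hx, zero_pow two_ne_zero]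

theorem pow_mul_card_pow_le_addEnergy_graph [DecidableEq G] [DecidableEq (AddChar G ℂ)]
    {f : G → ℂ} (hf : ∀ x, ‖f x‖ ≤ 1) {χ : G → AddChar G ℂ} {H : Finset G} {c : ℝ} (hc : 0 ≤ c)
    (hH : ∀ h ∈ H, c ≤ ‖charCoeff (mulDeriv f h) (χ h)‖ ^ 2)
    (hcard : c * Fintype.card G ≤ #H) :
    c ^ 8 * (Fintype.card G : ℝ) ^ 3 ≤ E[H.image fun h => (h, χ h)] := by
  have hN : (0 : ℝ) < Fintype.card G := by exact_mod_cast Fintype.card_pos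
  set w : G → ℝ := fun h => if h ∈ H then 1 else 0
  have hweighted : c ^ 2 ≤ 𝔼 h, w h * ‖charCoeff (mulDeriv f h) (χ h)‖ ^ 2 := by
    rw [Fintype.expect_eq_sum_div_card, le_div_iff₀ hN]
    calc c ^ 2 * Fintype.card G = c * Fintype.card G * c := by ring
      _ ≤ #H * c := by gcongr
      _ ≤ ∑ h ∈ H, ‖charCoeff (mulDeriv f h) (χ h)‖ ^ 2 := by
          simpa using card_nsmul_le_sum H _ c hH
      _ = _ := by simp [w, sum_ite_mem]
  have hpow : c ^ 8 ≤ (𝔼 h, w h * ‖charCoeff (mulDeriv f h) (χ h)‖ ^ 2) ^ 4 := by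
    calc c ^ 8 = (c ^ 2) ^ 4 := by ring
      _ ≤ _ := by gcongr
  rw [← le_div_iff₀ (by positivity)]
  refine (hpow.trans (expect_mul_norm_charCoeff_sq_pow_four_le w χ hf)).trans_eq ?_
  simp only [expect_norm_sq_expect_mul_addChar, ← sum_addConvolution_neg_sq, Nat.cast_sum,
    Nat.cast_pow]
  rw [Fintype.expect_eq_sum_div_card, ← sum_div, div_div, ← pow_succ, Fintype.sum_prod_type]
  congr 1
  refine sum_congr rfl fun d _ => sum_congr rfl fun e _ => ?_
  rw [addConvolution_neg_image_graph, ← filter_filter, ← sum_boole]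
  simp only [w, ite_zero_mul_ite_zero, mul_one]

end Derivatives

section AffineFrequencies

open Finset
open scoped Combinatorics.Additive

variable {p : ℕ} [Fact p.Prime] {V : Type*} [AddCommGroup V] [Module (ZMod p) V]

theorem injective_stdAddChar_comp :
    Function.Injective fun φ : Module.Dual (ZMod p) V =>
      (ZMod.stdAddChar : AddChar (ZMod p) ℂ).compAddMonoidHom φ.toAddMonoidHom :=
  fun _ _ h => LinearMap.ext fun x => ZMod.injective_stdAddChar (DFunLike.congr_fun h x)

theorem bijective_stdAddChar_comp [Finite V] :
    Function.Bijective fun φ : Module.Dual (ZMod p) V =>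
      (ZMod.stdAddChar : AddChar (ZMod p) ℂ).compAddMonoidHom φ.toAddMonoidHom := by
  have := Fintype.ofFinite V
  have hcard : Nat.card (Module.Dual (ZMod p) V) = Nat.card (AddChar V ℂ) := by
    rw [← Nat.card_congr (Module.finBasis (ZMod p) V).toDualEquiv.toEquiv,
      Nat.card_eq_fintype_card, Nat.card_eq_fintype_card, AddChar.card_eq]
  exact (Nat.bijective_iff_injective_and_card _).2 ⟨injective_stdAddChar_comp, hcard⟩

variable [Fintype V]

/-- The identification of the dual of a finite vector space `V` over `𝔽_p` with the group of
characters of `V`, sending `φ` to `x ↦ exp (2πi φ(x) / p)`. -/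
noncomputable def dualChar : Module.Dual (ZMod p) V ≃+ AddChar V ℂ where
  __ := Equiv.ofBijective _ bijective_stdAddChar_comp
  map_add' φ ψ := DFunLike.ext _ _ fun x => ZMod.stdAddChar.map_add_eq_mul (φ x) (ψ x)

theorem dualChar_apply (φ : Module.Dual (ZMod p) V) (x : V) :
    dualChar φ x = ZMod.stdAddChar (φ x) := rfl

/-- The correlation guaranteed by the affine form of the inverse theorem: a function on a vector
space over `𝔽_p` with `‖f‖_{U³}⁸ ≥ η` has derivatives correlating on average to this extent with
characters depending affinely on the direction. -/
noncomputable def affineCorrelation (p : ℕ) (η : ℝ) : ℝ :=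
  (η / 2) ^ 8 / 4 * (η / 2) / freimanLoss p ((η / 2) ^ 8) * (η / 2)

theorem affineCorrelation_pos {η : ℝ} (hη : 0 < η) : 0 < affineCorrelation p η := by
  have := freimanLoss_pos (p := p) (κ := (η / 2) ^ 8) (by positivity)
  unfold affineCorrelation
  positivity

theorem exists_affine_dualChar_eq [DecidableEq V] [DecidableEq (AddChar V ℂ)] {H : Finset V}
    (hH : H.Nonempty) (χ : V → AddChar V ℂ) {κ : ℝ} (hκ : 0 < κ)
    (h : κ * (#H : ℝ) ^ 3 ≤ E[H.image fun h => (h, χ h)]) :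
    ∃ (B : LinearMap.BilinForm (ZMod p) V) (b : Module.Dual (ZMod p) V),
      κ / 4 * #H ≤ freimanLoss p κ * (#{h ∈ H | χ h = dualChar (B h + b)} : ℝ) := by
  let _ : Module (ZMod p) (AddChar V ℂ) := AddCommGroup.zmodModule fun χ => by
    ext x
    rw [AddChar.nsmul_apply, ← AddChar.map_nsmul_eq_pow, ZModModule.char_nsmul_eq_zero,
      AddChar.map_zero_eq_one, AddChar.zero_apply]
  obtain ⟨L, b, hLb⟩ := exists_affine_eq_of_le_addEnergy_graph (p := p) hH χ hκ h
  refine ⟨(dualChar.symm.toAddMonoidHom.comp L.toAddMonoidHom).toZModLinearMap p,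
    dualChar.symm b, hLb.trans_eq ?_⟩
  simp

theorem exists_affineCorrelation_le {f : V → ℂ} (hf : ∀ x, ‖f x‖ ≤ 1) {η : ℝ} (hη : 0 < η)
    (hfη : η ≤ gowersU3Energy f) :
    ∃ (B : LinearMap.BilinForm (ZMod p) V) (b : Module.Dual (ZMod p) V),
      affineCorrelation p η ≤ 𝔼 h, ‖charCoeff (mulDeriv f h) (dualChar (B h + b))‖ ^ 2 := by
  classical
  set c := η / 2 with hc
  have hc0 : 0 < c := by positivity
  have hloss : (0 : ℝ) < freimanLoss p (c ^ 8) := by exact_mod_cast freimanLoss_pos (pow_pos hc0 8)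
  have hN : (0 : ℝ) < Fintype.card V := by exact_mod_cast Fintype.card_pos
  obtain ⟨χ, hχ⟩ := exists_gowersU3Energy_le_expect_norm_charCoeff hf
  obtain ⟨H, hH, hHcard⟩ := exists_finset_of_two_mul_le_expect (c := c)
    (fun h => pow_le_one₀ (norm_nonneg _) (norm_charCoeff_le_one (norm_mulDeriv_le_one hf h) (χ h)))
    hc0.le (by linarith)
  have hH0 : (0 : ℝ) < #H := lt_of_lt_of_le (by positivity) hHcard
  have henergy : c ^ 8 * (#H : ℝ) ^ 3 ≤ E[H.image fun h => (h, χ h)] := by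
    refine le_trans ?_ (pow_mul_card_pow_le_addEnergy_graph hf hc0.le hH hHcard)
    gcongr
    exact card_le_univ H
  obtain ⟨B, b, hBb⟩ := exists_affine_dualChar_eq (p := p)
    (card_pos.1 (by exact_mod_cast hH0)) χ (pow_pos hc0 8) henergy
  refine ⟨B, b, ?_⟩
  rw [Fintype.expect_eq_sum_div_card, le_div_iff₀ hN]
  calc affineCorrelation p η * Fintype.card V
      = c ^ 8 / 4 * (c * Fintype.card V) / freimanLoss p (c ^ 8) * c := by
        rw [affineCorrelation]; ring
    _ ≤ c ^ 8 / 4 * #H / freimanLoss p (c ^ 8) * c := by gcongr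
    _ ≤ #{h ∈ H | χ h = dualChar (B h + b)} * c := by
        gcongr
        rwa [div_le_iff₀' hloss]
    _ ≤ ∑ h ∈ H with χ h = dualChar (B h + b),
          ‖charCoeff (mulDeriv f h) (dualChar (B h + b))‖ ^ 2 := by
        rw [← nsmul_eq_mul]
        refine card_nsmul_le_sum _ _ _ fun h hh => ?_
        rw [← (mem_filter.1 hh).2]
        exact hH h (mem_filter.1 hh).1
    _ ≤ _ := sum_le_univ_sum_of_nonneg fun _ => by positivity

end AffineFrequencies

section Symmetrization

open Finset ComplexConjugate

variable {p : ℕ} [Fact p.Prime] {V : Type*} [AddCommGroup V] [Module (ZMod p) V]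

/-- The quadratic phase `x ↦ exp (πi S(x, x) / p)`, where the half is taken in `𝔽_p`. -/
noncomputable def quadraticPhase (S : LinearMap.BilinForm (ZMod p) V) (x : V) : ℂ :=
  ZMod.stdAddChar (2⁻¹ * S x x)

theorem norm_quadraticPhase (S : LinearMap.BilinForm (ZMod p) V) (x : V) :
    ‖quadraticPhase S x‖ = 1 :=
  AddChar.norm_apply _ _

theorem exists_isSymm_isAlt_add_eq [NeZero (2 : ZMod p)] (B : LinearMap.BilinForm (ZMod p) V) :
    ∃ S A : LinearMap.BilinForm (ZMod p) V, S.IsSymm ∧ A.IsAlt ∧ S + A = B := by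
  refine ⟨(2⁻¹ : ZMod p) • (B + B.flip), (2⁻¹ : ZMod p) • (B - B.flip), ⟨fun x y => ?_⟩,
    fun x => ?_, ?_⟩
  · simp [add_comm]
  · simp
  · rw [← smul_add, show B + B.flip + (B - B.flip) = B + B by abel, ← two_smul (ZMod p) B,
      inv_smul_smul₀ two_ne_zero]

theorem apply_eq_of_forall_mem_range {A : LinearMap.BilinForm (ZMod p) V} (hA : A.IsAlt) {x y : V}
    (h : ∀ φ ∈ LinearMap.range A, φ x = φ y) : A x = A y := by
  ext z
  rw [← hA.neg_eq z x, ← hA.neg_eq z y, h (A z) (LinearMap.mem_range_self A z)]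

variable [Fintype V]

theorem quadraticPhase_add [NeZero (2 : ZMod p)] {S : LinearMap.BilinForm (ZMod p) V}
    (hS : S.IsSymm) (x h : V) :
    quadraticPhase S (x + h) = quadraticPhase S x * quadraticPhase S h * dualChar (S h) x := by
  have h2 : (2 : ZMod p)⁻¹ * 2 = 1 := inv_mul_cancel₀ two_ne_zero
  simp only [quadraticPhase, dualChar_apply, ← AddChar.map_add_eq_mul, map_add,
    LinearMap.add_apply]
  congr 1
  have hxh : S x h = S h x := hS.eq x h
  linear_combination 2⁻¹ * hxh + S h x * h2

theorem mulDeriv_mul_quadraticPhase [NeZero (2 : ZMod p)] (f : V → ℂ)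
    {S : LinearMap.BilinForm (ZMod p) V} (hS : S.IsSymm) (h x : V) :
    mulDeriv (fun y => f y * quadraticPhase S y) h x =
      quadraticPhase S h * (mulDeriv f h x * dualChar (S h) x) := by
  have hunit : conj (quadraticPhase S x) * quadraticPhase S x = 1 := by
    rw [Complex.conj_mul', norm_quadraticPhase]
    norm_num
  simp only [mulDeriv, map_mul, quadraticPhase_add hS]
  linear_combination conj (f x) * f (x + h) * quadraticPhase S h * dualChar (S h) x * hunit

theorem norm_charCoeff_mulDeriv_mul_quadraticPhase [NeZero (2 : ZMod p)] (f : V → ℂ)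
    {S : LinearMap.BilinForm (ZMod p) V} (hS : S.IsSymm) (h : V) (φ : Module.Dual (ZMod p) V) :
    ‖charCoeff (mulDeriv (fun y => f y * quadraticPhase S y) h) (dualChar φ)‖ =
      ‖charCoeff (mulDeriv f h) (dualChar (S h + φ))‖ := by
  have hcoeff : charCoeff (mulDeriv (fun y => f y * quadraticPhase S y) h) (dualChar φ) =
      quadraticPhase S h * charCoeff (mulDeriv f h) (dualChar (S h + φ)) := by
    simp only [charCoeff, mulDeriv_mul_quadraticPhase f hS, mul_expect, map_add, AddChar.add_apply,
      mul_assoc]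
  rw [hcoeff, norm_mul, norm_quadraticPhase, one_mul]

theorem expect_comp_eq_expect_of_surjective {G H : Type*} [AddCommGroup G] [Fintype G]
    [AddCommGroup H] [Fintype H] (ψ : G →+ H) (hψ : Function.Surjective ψ) (F : H → ℝ) :
    𝔼 a, F (ψ a) = 𝔼 y, F y := by
  have htranslate : ∀ y, 𝔼 a, F (ψ a + y) = 𝔼 a, F (ψ a) := fun y => by
    obtain ⟨x, rfl⟩ := hψ y
    simp only [← map_add, add_comm _ x]
    exact (expect_eq_expect_add_left x fun a => F (ψ a)).symm
  calc 𝔼 a, F (ψ a) = 𝔼 y, 𝔼 a, F (ψ a + y) := by simp only [htranslate, Fintype.expect_const]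
    _ = 𝔼 a : G, 𝔼 y, F y := by
        rw [expect_comm]
        exact expect_congr rfl fun a _ => (expect_eq_expect_add_left (ψ a) F).symm
    _ = 𝔼 y, F y := Fintype.expect_const _

/-- The fourth power of the `U²`-norm of `u` with a twist by the bilinear form `B`, which is absent
when `B = 0`. -/
noncomputable def twistedEnergy (B : LinearMap.BilinForm (ZMod p) V) (u : V → ℂ) : ℝ :=
  𝔼 h, ‖charCoeff (mulDeriv u h) (dualChar (B h))‖ ^ 2

theorem ofReal_twistedEnergy (B : LinearMap.BilinForm (ZMod p) V) (u : V → ℂ) :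
    (twistedEnergy B u : ℂ) = 𝔼 a, 𝔼 b, 𝔼 c,
      u a * conj (u b) * conj (u c) * u (b + c - a) * dualChar (B (b - a)) (c - a) := by
  simp only [twistedEnergy, Complex.ofReal_expect, ofReal_norm_charCoeff_sq]
  simp_rw [fun h => expect_comm univ univ fun k x =>
    mulDeriv (mulDeriv u h) k x * dualChar (B h) k]
  rw [expect_comm]
  refine expect_congr rfl fun a _ => ?_
  symm
  rw [expect_eq_expect_add_left a]
  refine expect_congr rfl fun h _ => ?_
  rw [expect_eq_expect_add_left a]
  refine expect_congr rfl fun k _ => ?_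
  have hsum : a + h + (a + k) - a = a + k + h := by abel
  simp only [mulDeriv, map_mul, Complex.conj_conj, hsum, add_sub_cancel_left]
  ring

/-- The Cauchy–Schwarz inequality decouples the variables `x` and `x + h`, and the shift `b`
of the frequencies only contributes a phase in `x`. -/
theorem expect_norm_charCoeff_affine_sq_sq_le {u : V → ℂ} (hu : ∀ x, ‖u x‖ ≤ 1)
    (B : LinearMap.BilinForm (ZMod p) V) (b : Module.Dual (ZMod p) V) :
    (𝔼 h, ‖charCoeff (mulDeriv u h) (dualChar (B h + b))‖ ^ 2) ^ 2 ≤ twistedEnergy B.flip u := by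
  have hcs := expect_mul_norm_charCoeff_sq_sq_le (fun _ => 1) (fun h => dualChar (B h + b)) hu
  simp only [one_mul, Complex.ofReal_one] at hcs
  refine hcs.trans_eq (expect_congr rfl fun k _ => ?_)
  have hshift : ∀ x, 𝔼 h, dualChar (B h + b) k * mulDeriv u k (x + h) =
      ZMod.stdAddChar (b k - B x k) * charCoeff (mulDeriv u k) (dualChar (B.flip k)) := by
    intro x
    rw [charCoeff, expect_eq_expect_add_left x (fun z => mulDeriv u k z * _), mul_expect]
    refine expect_congr rfl fun h _ => ?_
    have hphase : (B h + b) k = b k - B x k + B.flip k (x + h) := by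
      simp only [LinearMap.add_apply, LinearMap.BilinForm.flip_apply, map_add]
      ring
    rw [dualChar_apply, dualChar_apply, hphase, AddChar.map_add_eq_mul]
    ring
  simp only [hshift, norm_mul, AddChar.norm_apply, one_mul, Fintype.expect_const]

theorem card_range_mul_expect_norm_charCoeff_sq_le_one {u : V → ℂ} (hu : ∀ x, ‖u x‖ ≤ 1)
    (B : LinearMap.BilinForm (ZMod p) V) :
    Nat.card (LinearMap.range B) * 𝔼 a, ‖charCoeff u (dualChar (B a))‖ ^ 2 ≤ 1 := by
  let _ : Fintype (LinearMap.range B) := Fintype.ofFinite _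
  let e : LinearMap.range B ↪ AddChar V ℂ :=
    ⟨fun φ => dualChar (φ : Module.Dual (ZMod p) V), dualChar.injective.comp Subtype.val_injective⟩
  calc (Nat.card (LinearMap.range B) : ℝ) * 𝔼 a, ‖charCoeff u (dualChar (B a))‖ ^ 2
      = Fintype.card (LinearMap.range B) * 𝔼 φ, ‖charCoeff u (e φ)‖ ^ 2 := by
        rw [Nat.card_eq_fintype_card, ← expect_comp_eq_expect_of_surjective
          (B.rangeRestrict : V →+ LinearMap.range B) B.surjective_rangeRestrict]
        rfl
    _ = ∑ χ ∈ univ.map e, ‖charCoeff u χ‖ ^ 2 := by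
        rw [Fintype.card_mul_expect, sum_map]
    _ ≤ ∑ χ, ‖charCoeff u χ‖ ^ 2 := sum_le_univ_sum_of_nonneg fun χ => by positivity
    _ ≤ 1 := sum_norm_charCoeff_sq_le_one hu

/-- In the variables `a` and `s = b + c`, the phase `A (b - a, c - a)` of an alternating form is
`A (b, s) - A (a, s) + 2 A (a, b)`, so that the average over `b` is a Fourier coefficient at the
frequency `2 A a`. -/
theorem ofReal_twistedEnergy_of_isAlt {A : LinearMap.BilinForm (ZMod p) V} (hA : A.IsAlt)
    (u : V → ℂ) :
    (twistedEnergy A u : ℂ) = 𝔼 s, 𝔼 a, (u a * u (s - a) * dualChar (-A a) s) *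
      charCoeff (fun b => conj (u b) * conj (u (s - b)) * dualChar (A b) s)
        (dualChar (((2 : ZMod p) • A) a)) := by
  symm
  rw [ofReal_twistedEnergy, expect_comm]
  refine expect_congr rfl fun a _ => ?_
  simp only [charCoeff, mul_expect]
  rw [expect_comm]
  refine expect_congr rfl fun b _ => ?_
  rw [expect_eq_expect_add_left b]
  refine expect_congr rfl fun c _ => ?_
  have hphase : A (b - a) (c - a) =
      (-A a) (b + c) + A b (b + c) + ((2 : ZMod p) • A) a b := by
    simp only [map_sub, map_add, LinearMap.sub_apply, LinearMap.neg_apply, LinearMap.smul_apply,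
      smul_eq_mul, hA.self_eq_zero, ← hA.neg_eq a b]
    ring
  simp only [dualChar_apply, hphase, add_sub_cancel_left]
  rw [AddChar.map_add_eq_mul, AddChar.map_add_eq_mul]
  ring

theorem card_range_mul_twistedEnergy_sq_le_one [NeZero (2 : ZMod p)]
    {A : LinearMap.BilinForm (ZMod p) V} (hA : A.IsAlt) {u : V → ℂ} (hu : ∀ x, ‖u x‖ ≤ 1) :
    Nat.card (LinearMap.range A) * twistedEnergy A u ^ 2 ≤ 1 := by
  set β : V → V → ℂ := fun s b => conj (u b) * conj (u (s - b)) * dualChar (A b) s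
  have hβ : ∀ s b, ‖β s b‖ ≤ 1 := fun s b => by
    simpa [β] using norm_mul_le_one (hu b) (hu (s - b))
  have hw : ∀ s a, ‖u a * u (s - a) * dualChar (-A a) s‖ ≤ 1 := fun s a => by
    simpa using norm_mul_le_one (hu a) (hu (s - a))
  have hcs : twistedEnergy A u ^ 2 ≤
      𝔼 s, 𝔼 a, ‖charCoeff (β s) (dualChar (((2 : ZMod p) • A) a))‖ ^ 2 := by
    rw [← sq_norm_ofReal, ofReal_twistedEnergy_of_isAlt hA]
    exact norm_expect_expect_mul_sq_le hw
  calc (Nat.card (LinearMap.range A) : ℝ) * twistedEnergy A u ^ 2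
      ≤ Nat.card (LinearMap.range A) *
          𝔼 s, 𝔼 a, ‖charCoeff (β s) (dualChar (((2 : ZMod p) • A) a))‖ ^ 2 := by gcongr
    _ = 𝔼 s, Nat.card (LinearMap.range ((2 : ZMod p) • A)) *
          𝔼 a, ‖charCoeff (β s) (dualChar (((2 : ZMod p) • A) a))‖ ^ 2 := by
        rw [mul_expect, LinearMap.range_smul _ _ two_ne_zero]
    _ ≤ 1 := expect_le univ_nonempty fun s _ =>
        card_range_mul_expect_norm_charCoeff_sq_le_one (hβ s) _

theorem exists_norm_le_card_mul_norm {ι E : Type*} [Fintype ι] [Nonempty ι]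
    [SeminormedAddCommGroup E] {t : ι → E} {z : E} (hz : z = ∑ i, t i) :
    ∃ i, ‖z‖ ≤ Fintype.card ι * ‖t i‖ := by
  obtain ⟨i, hi⟩ := Finite.exists_max fun i => ‖t i‖
  refine ⟨i, hz ▸ (norm_sum_le _ _).trans ?_⟩
  simpa [nsmul_eq_mul] using sum_le_sum fun j (_ : j ∈ univ) => hi j

/-- On the set where `A a = P` and `A b = Q` the phase `A (b - a, c - a)` is a sum of functions of
`b` and of `c`. -/
theorem ofReal_twistedEnergy_eq_sum_range {A : LinearMap.BilinForm (ZMod p) V} (hA : A.IsAlt)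
    [Fintype (LinearMap.range A)] (u : V → ℂ) :
    (twistedEnergy A u : ℂ) = ∑ q : LinearMap.range A × LinearMap.range A, 𝔼 a, 𝔼 b, 𝔼 c,
      {x | A x = q.1}.indicator u a *
        {x | A x = q.2}.indicator (fun x => conj (u x) * dualChar (q.1 : Module.Dual (ZMod p) V) x)
          b *
        (conj (u c) * dualChar (q.2 - q.1 : Module.Dual (ZMod p) V) c) * u (b + c - a) := by
  classical
  simp only [← expect_sum_comm]
  rw [ofReal_twistedEnergy]
  refine expect_congr rfl fun a _ => expect_congr rfl fun b _ => expect_congr rfl fun c _ => ?_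
  rw [Fintype.sum_eq_single (A.rangeRestrict a, A.rangeRestrict b)]
  · have hphase : A (b - a) (c - a) = A a b + (A b - A a) c := by
      simp only [map_sub, LinearMap.sub_apply, hA.self_eq_zero, ← hA.neg_eq a b]
      ring
    simp only [LinearMap.codRestrict_apply, LinearMap.rangeRestrict, Set.indicator,
      Set.mem_ofPred_eq, if_true, dualChar_apply, hphase, AddChar.map_add_eq_mul]
    ring
  · rintro ⟨⟨P, hP⟩, ⟨Q, hQ⟩⟩ hPQ
    by_cases hPa : A a = P
    · have hQb : A b ≠ Q := by
        rintro rfl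
        subst hPa
        exact hPQ rfl
      simp [hQb]
    · simp [hPa]

theorem exists_twistedEnergy_le_card_range_sq_mul {A : LinearMap.BilinForm (ZMod p) V}
    (hA : A.IsAlt) {u : V → ℂ} (hu : ∀ x, ‖u x‖ ≤ 1) :
    ∃ φ ξ : Module.Dual (ZMod p) V, twistedEnergy A u ≤ (Nat.card (LinearMap.range A) : ℝ) ^ 2 *
      ‖charCoeff ({x | A x = φ}.indicator u) (dualChar ξ)‖ := by
  let _ : Fintype (LinearMap.range A) := Fintype.ofFinite _
  obtain ⟨⟨⟨P, _⟩, ⟨Q, _⟩⟩, hPQ⟩ :=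
    exists_norm_le_card_mul_norm (ofReal_twistedEnergy_eq_sum_range hA u)
  obtain ⟨χ, hχ⟩ := exists_le_norm_charCoeff (u₁ := {x | A x = P}.indicator u)
    (u₂ := {x | A x = Q}.indicator fun x => conj (u x) * dualChar P x)
    (u₃ := fun c => conj (u c) * dualChar (Q - P) c)
    (fun b => (norm_indicator_le_norm_self _ _).trans (by simpa using hu b))
    (fun c => by simpa using hu c) hu
  obtain ⟨ξ, rfl⟩ := dualChar (p := p).surjective χ
  refine ⟨P, ξ, (le_abs_self _).trans ?_⟩
  rw [← Real.norm_eq_abs, ← Complex.norm_real]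
  refine hPQ.trans ?_
  rw [Fintype.card_prod, Nat.cast_mul, ← sq, ← Nat.card_eq_fintype_card]
  gcongr

theorem pow_ten_le_norm_charCoeff_indicator [NeZero (2 : ZMod p)]
    {A : LinearMap.BilinForm (ZMod p) V} (hA : A.IsAlt) {u : V → ℂ} (hu : ∀ x, ‖u x‖ ≤ 1) {c : ℝ}
    (hc : 0 < c) (hcA : c ^ 2 ≤ twistedEnergy A u) :
    Nat.card (LinearMap.range A) ≤ 1 / c ^ 4 ∧
      ∃ φ ξ : Module.Dual (ZMod p) V,
        c ^ 10 ≤ ‖charCoeff ({x | A x = φ}.indicator u) (dualChar ξ)‖ := by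
  have hrange : Nat.card (LinearMap.range A) * c ^ 4 ≤ 1 :=
    calc Nat.card (LinearMap.range A) * c ^ 4
        = Nat.card (LinearMap.range A) * (c ^ 2) ^ 2 := by ring
      _ ≤ Nat.card (LinearMap.range A) * twistedEnergy A u ^ 2 := by gcongr
      _ ≤ 1 := card_range_mul_twistedEnergy_sq_le_one hA hu
  refine ⟨(le_div_iff₀ (by positivity)).2 hrange, ?_⟩
  obtain ⟨φ, ξ, hφξ⟩ := exists_twistedEnergy_le_card_range_sq_mul hA hu
  refine ⟨φ, ξ, ?_⟩
  set m := ‖charCoeff ({x | A x = φ}.indicator u) (dualChar ξ)‖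
  have : 0 ≤ m := norm_nonneg _
  calc c ^ 10 = c ^ 2 * c ^ 8 := by ring
    _ ≤ (Nat.card (LinearMap.range A) ^ 2 * m) * c ^ 8 := by
        gcongr
        exact hcA.trans hφξ
    _ = (Nat.card (LinearMap.range A) * c ^ 4) ^ 2 * m := by ring
    _ ≤ 1 ^ 2 * m := by gcongr
    _ = m := by ring

theorem exists_affineCorrelation_sq_le_twistedEnergy [NeZero (2 : ZMod p)] {f : V → ℂ}
    (hf : ∀ x, ‖f x‖ ≤ 1) {η : ℝ} (hη : 0 < η) (hfη : η ≤ gowersU3Energy f) :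
    ∃ S A : LinearMap.BilinForm (ZMod p) V, A.IsAlt ∧
      affineCorrelation p η ^ 2 ≤ twistedEnergy A fun x => f x * quadraticPhase S x := by
  obtain ⟨B, b, hBb⟩ := exists_affineCorrelation_le (p := p) hf hη hfη
  obtain ⟨S, A, hS, hA, rfl⟩ := exists_isSymm_isAlt_add_eq B
  refine ⟨S, A.flip, fun x => hA x, ?_⟩
  have hu : ∀ x, ‖f x * quadraticPhase S x‖ ≤ 1 := fun x =>
    norm_mul_le_one (hf x) (norm_quadraticPhase S x).le
  refine le_trans ?_ (expect_norm_charCoeff_affine_sq_sq_le hu A b)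
  simp only [norm_charCoeff_mulDeriv_mul_quadraticPhase f hS, ← add_assoc,
    ← LinearMap.add_apply]
  have := affineCorrelation_pos (p := p) hη
  gcongr

theorem exists_quadratic_le_norm_expect_mul [NeZero (2 : ZMod p)] {f : V → ℂ}
    (hf : ∀ x, ‖f x‖ ≤ 1) {η : ℝ} (hη : 0 < η) (hfη : η ≤ gowersU3Energy f) :
    ∃ (R : Finset (Module.Dual (ZMod p) V)) (q : QuadraticForm (ZMod p) V) (g : V → ℂ),
      #R ≤ ⌊1 / affineCorrelation p η ^ 4⌋₊ + 1 ∧ (∀ x, ‖g x‖ ≤ 1) ∧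
      (∀ x y, (∀ φ ∈ R, φ x = φ y) → q x = q y → g x = g y) ∧
      affineCorrelation p η ^ 10 ≤ ‖𝔼 x, f x * g x‖ := by
  classical
  obtain ⟨S, A, hA, henergy⟩ := exists_affineCorrelation_sq_le_twistedEnergy (p := p) hf hη hfη
  have hu : ∀ x, ‖f x * quadraticPhase S x‖ ≤ 1 := fun x =>
    norm_mul_le_one (hf x) (norm_quadraticPhase S x).le
  obtain ⟨hrange, φ, ξ, hφξ⟩ := pow_ten_le_norm_charCoeff_indicator hA hu
    (affineCorrelation_pos hη) henergy
  let _ : Fintype (LinearMap.range A) := Fintype.ofFinite _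
  let range : Finset (Module.Dual (ZMod p) V) :=
    univ.map (Function.Embedding.subtype (· ∈ LinearMap.range A))
  have hcard : #range = Nat.card (LinearMap.range A) := by
    rw [card_map, card_univ, Nat.card_eq_fintype_card]
  refine ⟨insert ξ range, S.toQuadraticMap,
    {x | A x = φ}.indicator fun x => quadraticPhase S x * dualChar ξ x, ?_, fun x => ?_,
    fun x y hxy hSxy => ?_, hφξ.trans_eq ?_⟩
  · exact (card_insert_le _ _).trans
      (Nat.add_le_add_right (hcard ▸ Nat.le_floor hrange) 1)
  · exact (norm_indicator_le_norm_self _ _).trans (by simp [norm_quadraticPhase])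
  · have hAxy : A x = A y := apply_eq_of_forall_mem_range hA fun ψ hψ =>
      hxy ψ (mem_insert_of_mem (mem_map.2 ⟨⟨ψ, hψ⟩, mem_univ _, rfl⟩))
    rw [LinearMap.BilinMap.toQuadraticMap_apply, LinearMap.BilinMap.toQuadraticMap_apply] at hSxy
    have hξ : ξ x = ξ y := hxy ξ (mem_insert_self _ _)
    simp [Set.indicator, hAxy, quadraticPhase, hSxy, dualChar_apply, hξ]
  · congr 1
    refine expect_congr rfl fun x _ => ?_
    by_cases hx : A x = φ <;> simp [Set.indicator, hx, mul_assoc]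

end Symmetrization

section ClassAverages

open Finset ComplexConjugate

variable {α : Type*} [Fintype α]

open Classical in
/-- The conditional expectation of `f` with respect to the partition into classes of `s`: its value
at `x` is the average of `f` over the class of `x`. -/
noncomputable def classAverage (s : Setoid α) (f : α → ℂ) (x : α) : ℂ :=
  𝔼 y with s x y, f y

theorem filter_rel_eq_of_rel {s : Setoid α} [DecidableRel s] {x y : α} (h : s x y) :
    univ.filter (s x) = univ.filter (s y) := by
  ext z
  rw [mem_filter_univ, mem_filter_univ]
  exact ⟨s.trans (s.symm h), s.trans h⟩

theorem classAverage_eq_of_rel {s : Setoid α} (f : α → ℂ) {x y : α} (h : s x y) :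
    classAverage s f x = classAverage s f y := by
  classical
  rw [classAverage, classAverage, filter_rel_eq_of_rel h]

theorem norm_classAverage_le_one (s : Setoid α) {f : α → ℂ} (hf : ∀ x, ‖f x‖ ≤ 1) (x : α) :
    ‖classAverage s f x‖ ≤ 1 := by
  classical
  exact (RCLike.norm_expect_le (K := ℂ)).trans
    (expect_le ⟨x, mem_filter_univ x |>.2 (s.refl x)⟩ fun y _ => hf y)

theorem expect_classAverage (s : Setoid α) (f : α → ℂ) :
    𝔼 x, classAverage s f x = 𝔼 x, f x := by
  classical
  simp only [Fintype.expect_eq_sum_div_card]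
  congr 1
  calc ∑ x, classAverage s f x
      = ∑ x, ∑ y with s x y, f y / #{z | s y z} := by
        refine sum_congr rfl fun x _ => ?_
        rw [classAverage, expect_eq_sum_div_card, sum_div]
        refine sum_congr rfl fun y hy => ?_
        rw [filter_rel_eq_of_rel (mem_filter_univ y |>.1 hy)]
    _ = ∑ y, ∑ x with s y x, f y / #{z | s y z} := by
        simp only [sum_filter]
        rw [sum_comm]
        simp only [s.comm']
    _ = ∑ y, f y := by
        refine sum_congr rfl fun y _ => ?_
        have hpos : (#{z | s y z} : ℂ) ≠ 0 :=
          Nat.cast_ne_zero.2 (card_ne_zero_of_mem (mem_filter_univ y |>.2 (s.refl y)))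
        rw [sum_const, nsmul_eq_mul, mul_div_cancel₀ _ hpos]

theorem expect_classAverage_mul {s : Setoid α} (f : α → ℂ) {g : α → ℂ}
    (hg : ∀ x y, s x y → g x = g y) :
    𝔼 x, classAverage s f x * g x = 𝔼 x, f x * g x := by
  classical
  rw [← expect_classAverage s fun x => f x * g x]
  refine expect_congr rfl fun x _ => ?_
  rw [classAverage, classAverage, expect_mul]
  refine expect_congr rfl fun y hy => ?_
  rw [hg x y (mem_filter_univ y |>.1 hy)]

/-- Pythagoras: conditional expectations are orthogonal projections. -/
theorem expect_norm_classAverage_sq_add {s t : Setoid α} (hts : t ≤ s) (f : α → ℂ) :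
    𝔼 x, ‖classAverage s f x‖ ^ 2 + 𝔼 x, ‖classAverage t f x - classAverage s f x‖ ^ 2 =
      𝔼 x, ‖classAverage t f x‖ ^ 2 := by
  set u := classAverage s f
  set v := classAverage t f
  have hu : ∀ x y, s x y → conj (u x) = conj (u y) := fun x y h => by
    simp only [u, classAverage_eq_of_rel f h]
  have hcross : 𝔼 x, v x * conj (u x) = 𝔼 x, u x * conj (u x) :=
    (expect_classAverage_mul f fun x y h => hu x y (hts h)).trans
      (expect_classAverage_mul f hu).symm
  have hcross' : 𝔼 x, u x * conj (v x) = 𝔼 x, u x * conj (u x) := by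
    have hconj := congrArg conj hcross
    simpa only [map_expect, map_mul, Complex.conj_conj, mul_comm] using hconj
  have hexpand : ∀ x, (‖v x - u x‖ ^ 2 : ℂ) = v x * conj (v x) - v x * conj (u x) -
      u x * conj (v x) + u x * conj (u x) := fun x => by
    rw [← Complex.mul_conj', map_sub]
    ring
  have hcomplex : ((𝔼 x, ‖u x‖ ^ 2 + 𝔼 x, ‖v x - u x‖ ^ 2 : ℝ) : ℂ) =
      (𝔼 x, ‖v x‖ ^ 2 : ℝ) := by
    push_cast
    simp only [hexpand, expect_add_distrib, expect_sub_distrib, hcross, hcross',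
      ← Complex.mul_conj']
    ring
  exact_mod_cast hcomplex

theorem expect_norm_classAverage_sq_add_norm_expect_mul_sq_le [Nonempty α] {s t : Setoid α}
    (hts : t ≤ s) (f : α → ℂ) {g : α → ℂ} (hg : ∀ x y, t x y → g x = g y)
    (hg_one : ∀ x, ‖g x‖ ≤ 1) :
    𝔼 x, ‖classAverage s f x‖ ^ 2 + ‖𝔼 x, (f x - classAverage s f x) * g x‖ ^ 2 ≤
      𝔼 x, ‖classAverage t f x‖ ^ 2 := by
  have hcorr : 𝔼 x, (f x - classAverage s f x) * g x =
      𝔼 x, g x * (classAverage t f x - classAverage s f x) := by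
    simp only [sub_mul, expect_sub_distrib, mul_comm (g _),
      expect_classAverage_mul f hg]
  rw [← expect_norm_classAverage_sq_add hts f, hcorr]
  gcongr
  exact norm_expect_mul_sq_le hg_one

end ClassAverages

section EnergyIncrement

open Finset

variable {p : ℕ} {V : Type*} [AddCommGroup V] [Module (ZMod p) V]

/-- Two points are equivalent if no linear form in `R` and no quadratic form in `Q` separates
them: the partition into atoms of the quadratic factor generated by `R` and `Q`. -/
def quadraticSetoid (R : Finset (Module.Dual (ZMod p) V))
    (Q : Finset (QuadraticForm (ZMod p) V)) : Setoid V where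
  r x y := (∀ φ ∈ R, φ x = φ y) ∧ ∀ q ∈ Q, q x = q y
  iseqv :=
    { refl := fun _ => ⟨fun _ _ => rfl, fun _ _ => rfl⟩
      symm := fun h => ⟨fun φ hφ => (h.1 φ hφ).symm, fun q hq => (h.2 q hq).symm⟩
      trans := fun h h' => ⟨fun φ hφ => (h.1 φ hφ).trans (h'.1 φ hφ),
        fun q hq => (h.2 q hq).trans (h'.2 q hq)⟩ }

theorem quadraticSetoid_anti {R R' : Finset (Module.Dual (ZMod p) V)}
    {Q Q' : Finset (QuadraticForm (ZMod p) V)} (hR : R ⊆ R') (hQ : Q ⊆ Q') :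
    quadraticSetoid R' Q' ≤ quadraticSetoid R Q :=
  fun _ _ h => ⟨fun φ hφ => h.1 φ (hR hφ), fun q hq => h.2 q (hQ hq)⟩

theorem gowersU3Energy_mul_left {G : Type*} [AddCommGroup G] [Fintype G] (a : ℂ) (f : G → ℂ) :
    gowersU3Energy (fun x => a * f x) = ‖a‖ ^ 8 * gowersU3Energy f := by
  have hderiv : ∀ h k x, mulDeriv (mulDeriv (fun x => a * f x) h) k x =
      a ^ 2 * (starRingEnd ℂ a) ^ 2 * mulDeriv (mulDeriv f h) k x := fun h k x => by
    simp only [mulDeriv, map_mul, Complex.conj_conj]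
    ring
  simp only [gowersU3Energy, hderiv, ← mul_expect, norm_mul, norm_pow, RCLike.norm_conj, mul_pow]
  ring

variable [Fact p.Prime] [NeZero (2 : ZMod p)] [Fintype V]

theorem exists_energy_increment {f : V → ℂ} (hf : ∀ x, ‖f x‖ ≤ 1) {ε : ℝ} (hε : 0 < ε)
    {R : Finset (Module.Dual (ZMod p) V)} {Q : Finset (QuadraticForm (ZMod p) V)}
    (hlarge : ε ≤ gowersU3Energy fun x => f x - classAverage (quadraticSetoid R Q) f x) :
    ∃ R' Q', R ⊆ R' ∧ Q ⊆ Q' ∧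
      #R' ≤ #R + (⌊1 / affineCorrelation p (ε / 256) ^ 4⌋₊ + 1) ∧ #Q' ≤ #Q + 1 ∧
      𝔼 x, ‖classAverage (quadraticSetoid R Q) f x‖ ^ 2 + affineCorrelation p (ε / 256) ^ 20 ≤
        𝔼 x, ‖classAverage (quadraticSetoid R' Q') f x‖ ^ 2 := by
  classical
  set F : V → ℂ := fun x => f x - classAverage (quadraticSetoid R Q) f x
  have hhalf : ∀ x, ‖2⁻¹ * F x‖ ≤ 1 := fun x => by
    have hF : ‖F x‖ ≤ 1 + 1 :=
      (norm_sub_le _ _).trans (add_le_add (hf x) (norm_classAverage_le_one _ hf x))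
    rw [norm_mul, norm_inv, Complex.norm_ofNat]
    linarith
  have hhalf_large : ε / 256 ≤ gowersU3Energy fun x => 2⁻¹ * F x := by
    rw [gowersU3Energy_mul_left, norm_inv, Complex.norm_ofNat]
    linarith
  obtain ⟨R₁, q, g, hR₁, hg_one, hg, hcorr⟩ :=
    exists_quadratic_le_norm_expect_mul (p := p) hhalf (by positivity) hhalf_large
  refine ⟨R ∪ R₁, insert q Q, subset_union_left, subset_insert _ _,
    (card_union_le _ _).trans (by gcongr), card_insert_le _ _, ?_⟩
  have hinvariant : ∀ x y, quadraticSetoid (R ∪ R₁) (insert q Q) x y → g x = g y := fun x y h =>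
    hg x y (fun φ hφ => h.1 φ (mem_union_right _ hφ)) (h.2 q (mem_insert_self _ _))
  refine le_trans ?_ (expect_norm_classAverage_sq_add_norm_expect_mul_sq_le
    (quadraticSetoid_anti subset_union_left (subset_insert _ _)) f hinvariant hg_one)
  have hcorr_F : affineCorrelation p (ε / 256) ^ 10 ≤ ‖𝔼 x, F x * g x‖ := by
    simp only [mul_assoc, ← mul_expect, norm_mul, norm_inv, Complex.norm_ofNat] at hcorr
    linarith [norm_nonneg (𝔼 x, F x * g x)]
  have hpos := affineCorrelation_pos (p := p) (η := ε / 256) (by positivity)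
  rw [show 20 = 10 * 2 from rfl, pow_mul]
  gcongr

theorem exists_refinement_of_one_lt_energy_add {f : V → ℂ} (hf : ∀ x, ‖f x‖ ≤ 1) {ε : ℝ}
    (hε : 0 < ε) (m : ℕ) (R : Finset (Module.Dual (ZMod p) V))
    (Q : Finset (QuadraticForm (ZMod p) V))
    (henergy : 1 < 𝔼 x, ‖classAverage (quadraticSetoid R Q) f x‖ ^ 2 +
      m * affineCorrelation p (ε / 256) ^ 20) :
    ∃ R' Q', R ⊆ R' ∧ Q ⊆ Q' ∧
      #R' ≤ #R + m * (⌊1 / affineCorrelation p (ε / 256) ^ 4⌋₊ + 1) ∧ #Q' ≤ #Q + m ∧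
      gowersU3Energy (fun x => f x - classAverage (quadraticSetoid R' Q') f x) ≤ ε := by
  induction m generalizing R Q with
  | zero =>
    have hle : 𝔼 x, ‖classAverage (quadraticSetoid R Q) f x‖ ^ 2 ≤ 1 :=
      expect_le univ_nonempty fun x _ =>
        pow_le_one₀ (norm_nonneg _) (norm_classAverage_le_one _ hf x)
    simp only [Nat.cast_zero, zero_mul, add_zero] at henergy
    exact absurd hle henergy.not_ge
  | succ m ih =>
    rcases le_or_gt (gowersU3Energy fun x => f x - classAverage (quadraticSetoid R Q) f x) ε with
      hsmall | hlarge
    · exact ⟨R, Q, Subset.rfl, Subset.rfl, Nat.le_add_right _ _, Nat.le_add_right _ _, hsmall⟩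
    obtain ⟨R₁, Q₁, hRR₁, hQQ₁, hR₁, hQ₁, hincrement⟩ := exists_energy_increment hf hε hlarge.le
    obtain ⟨R₂, Q₂, hRR₂, hQQ₂, hR₂, hQ₂, hsmall⟩ := ih R₁ Q₁ (by push_cast at henergy; linarith)
    refine ⟨R₂, Q₂, hRR₁.trans hRR₂, hQQ₁.trans hQQ₂, ?_, by omega, hsmall⟩
    rw [Nat.succ_mul]
    omega

end EnergyIncrement

section QuadraticFactors

open Finset Module

variable {n : ℕ} {ι κ : Type} {φ : ι → F5Vec n → ZMod 5} {ψ : κ → F5Vec n → ZMod 5}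

theorem factorOf_le_of_range_subset (h : Set.range φ ⊆ Set.range ψ) :
    factorOf φ ≤ factorOf ψ := by
  choose σ hσ using fun i => h (Set.mem_range_self i)
  have hcomp : (fun x i => φ i x) = (fun c i => c (σ i)) ∘ fun x k => ψ k x := by
    simp only [← hσ, Function.comp_def]
  rw [factorOf, hcomp, ← MeasurableSpace.comap_comp]
  exact MeasurableSpace.comap_mono le_top

theorem factorOf_eq_of_range_eq (h : Set.range φ = Set.range ψ) : factorOf φ = factorOf ψ :=
  le_antisymm (factorOf_le_of_range_subset h.le) (factorOf_le_of_range_subset h.ge)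

theorem refinesFactor_of_le {B B' : MeasurableSpace (F5Vec n)} (h : B ≤ B') :
    RefinesFactor B' B := fun x =>
  ⟨x, Set.subset_iInter₂ fun s hx => Set.subset_iInter fun hs =>
    (measurableAtom_subset (h s hs) hx :)⟩

/-- The σ-algebra generated by a set `R` of linear forms. -/
abbrev dualFactor (R : Finset (Dual (ZMod 5) (F5Vec n))) : MeasurableSpace (F5Vec n) :=
  factorOf fun (φ : R) x => φ.1 x

/-- The σ-algebra generated by a set `R` of linear forms and a set `Q` of quadratic forms; its atoms
are the classes of `quadraticSetoid R Q`. -/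
abbrev quadraticFormFactor (R : Finset (Dual (ZMod 5) (F5Vec n)))
    (Q : Finset (QuadraticForm (ZMod 5) (F5Vec n))) : MeasurableSpace (F5Vec n) :=
  factorOf (Sum.elim (fun (φ : R) x => φ.1 x) fun (q : Q) x => q.1 x)

theorem dualFactor_mono {R R' : Finset (Dual (ZMod 5) (F5Vec n))} (hR : R ⊆ R') :
    dualFactor R ≤ dualFactor R' :=
  factorOf_le_of_range_subset (Set.range_subset_iff.2 fun φ => ⟨⟨φ.1, hR φ.2⟩, rfl⟩)

theorem quadraticFormFactor_mono {R R' : Finset (Dual (ZMod 5) (F5Vec n))}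
    {Q Q' : Finset (QuadraticForm (ZMod 5) (F5Vec n))} (hR : R ⊆ R') (hQ : Q ⊆ Q') :
    quadraticFormFactor R Q ≤ quadraticFormFactor R' Q' :=
  factorOf_le_of_range_subset (Set.range_subset_iff.2 <| Sum.rec
    (fun φ => ⟨.inl ⟨φ.1, hR φ.2⟩, rfl⟩) fun q => ⟨.inr ⟨q.1, hQ q.2⟩, rfl⟩)

theorem range_dotProduct_eq {d : ℕ} {r : Fin d → F5Vec n} {R : Finset (Dual (ZMod 5) (F5Vec n))}
    (hR : Set.range (fun j => dotProductEquiv (ZMod 5) (Fin n) (r j)) = R) :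
    Set.range (fun j x => r j ⬝ᵥ x) = Set.range fun (φ : R) x => φ.1 x := by
  change Set.range ((⇑) ∘ fun j => dotProductEquiv (ZMod 5) (Fin n) (r j)) =
    Set.range ((⇑) ∘ ((↑) : R → Dual (ZMod 5) (F5Vec n)))
  rw [Set.range_comp, Set.range_comp, hR, Subtype.range_coe]

theorem range_dotProduct_mulVec_eq {d : ℕ} {M : Fin d → Matrix (Fin n) (Fin n) (ZMod 5)}
    {Q : Finset (QuadraticForm (ZMod 5) (F5Vec n))}
    (hQ : Set.range (fun j => (M j).toQuadraticForm') = Q) :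
    Set.range (fun j x => x ⬝ᵥ (M j *ᵥ x)) = Set.range fun (q : Q) x => q.1 x := by
  have hform : (fun j x => x ⬝ᵥ (M j *ᵥ x)) = (⇑) ∘ fun j => (M j).toQuadraticForm' := by
    funext j x
    exact (Matrix.toLinearMap₂'_apply' _ _ _).symm
  change _ = Set.range ((⇑) ∘ ((↑) : Q → QuadraticForm (ZMod 5) (F5Vec n)))
  rw [hform, Set.range_comp, Set.range_comp, hQ, Subtype.range_coe]

theorem toQuadraticForm'_toMatrix' {R m : Type*} [CommRing R] [Invertible (2 : R)] [Fintype m]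
    [DecidableEq m] (q : QuadraticForm R (m → R)) : q.toMatrix'.toQuadraticForm' = q := by
  rw [QuadraticForm.toMatrix', Matrix.toQuadraticForm', Matrix.toLinearMap₂'_toMatrix',
    QuadraticMap.toQuadraticMap_associated]

theorem linQuadFactor_eq_quadraticFormFactor {d₁ d₂ : ℕ} {r : Fin d₁ → F5Vec n}
    {M : Fin d₂ → Matrix (Fin n) (Fin n) (ZMod 5)} {R : Finset (Dual (ZMod 5) (F5Vec n))}
    {Q : Finset (QuadraticForm (ZMod 5) (F5Vec n))}
    (hR : Set.range (fun j => dotProductEquiv (ZMod 5) (Fin n) (r j)) = R)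
    (hQ : Set.range (fun j => (M j).toQuadraticForm') = Q) :
    linQuadFactor r M = quadraticFormFactor R Q :=
  factorOf_eq_of_range_eq <| by
    rw [Set.Sum.elim_range, Set.Sum.elim_range, range_dotProduct_eq hR,
      range_dotProduct_mulVec_eq hQ]

theorem isQuadraticFactorLE_iff {B₁ B₂ : MeasurableSpace (F5Vec n)} {d₁ d₂ : ℕ} :
    IsQuadraticFactorLE B₁ B₂ d₁ d₂ ↔
      ∃ (R : Finset (Dual (ZMod 5) (F5Vec n))) (Q : Finset (QuadraticForm (ZMod 5) (F5Vec n))),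
        #R ≤ d₁ ∧ #Q ≤ d₂ ∧ B₁ = dualFactor R ∧ B₂ = quadraticFormFactor R Q := by
  classical
  constructor
  · rintro ⟨e₁, e₂, he₁, he₂, r, M, -, rfl, rfl⟩
    have hrange : ∀ {d : ℕ} {α : Type} [DecidableEq α] (u : Fin d → α),
        Set.range u = univ.image u := fun u => by rw [coe_image, coe_univ, Set.image_univ]
    refine ⟨_, _, card_image_le.trans ?_, card_image_le.trans ?_,
      factorOf_eq_of_range_eq (range_dotProduct_eq (hrange _)),
      linQuadFactor_eq_quadraticFormFactor (hrange _) (hrange _)⟩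
    · rwa [card_fin]
    · rwa [card_fin]
  · rintro ⟨R, Q, hRd, hQd, rfl, rfl⟩
    let _ : Invertible (2 : ZMod 5) := ⟨3, rfl, rfl⟩
    let r (j : Fin #R) := (dotProductEquiv (ZMod 5) (Fin n)).symm (R.equivFin.symm j)
    let M (j : Fin #Q) := (Q.equivFin.symm j).1.toMatrix'
    have hR : Set.range (fun j => dotProductEquiv (ZMod 5) (Fin n) (r j)) = R := by
      simp only [r, LinearEquiv.apply_symm_apply]
      exact (R.equivFin.symm.surjective.range_comp _).trans Subtype.range_coe
    have hQ : Set.range (fun j => (M j).toQuadraticForm') = Q := by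
      simp only [M, toQuadraticForm'_toMatrix']
      exact (Q.equivFin.symm.surjective.range_comp _).trans Subtype.range_coe
    exact ⟨#R, #Q, hRd, hQd, r, M, fun j => QuadraticForm.isSymm_toMatrix' _,
      (factorOf_eq_of_range_eq (range_dotProduct_eq hR)).symm,
      (linQuadFactor_eq_quadraticFormFactor hR hQ).symm⟩

theorem ofReal_condAvg_quadraticFormFactor (f : F5Vec n → ℝ)
    (R : Finset (Dual (ZMod 5) (F5Vec n))) (Q : Finset (QuadraticForm (ZMod 5) (F5Vec n)))
    (x : F5Vec n) :
    (condAvg f (quadraticFormFactor R Q) x : ℂ) =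
      classAverage (quadraticSetoid R Q) (fun y => (f y : ℂ)) x := by
  classical
  have hatom : ∀ y, y ∈ atomOf (quadraticFormFactor R Q) x ↔ quadraticSetoid R Q x y := fun y => by
    rw [atomOf_factorOf]
    change (∀ i, _ = _) ↔ (∀ φ ∈ R, φ x = φ y) ∧ ∀ q ∈ Q, q x = q y
    simp only [Sum.forall, Sum.elim_inl, Sum.elim_inr, Subtype.forall, eq_comm]
  simp only [condAvg, classAverage, hatom, Complex.ofReal_expect]

theorem gowersU3Pow_eq_gowersU3Energy (f : F5Vec n → ℝ) :
    gowersU3Pow f = gowersU3Energy fun x => (f x : ℂ) := by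
  have hderiv : ∀ h k x, mulDeriv (mulDeriv (fun x => (f x : ℂ)) h) k x =
      (f x * f (x + h) * f (x + k) * f (x + h + k) : ℝ) := fun h k x => by
    simp only [mulDeriv, map_mul, Complex.conj_ofReal, add_right_comm x h k]
    push_cast
    ring
  simp only [gowersU3Pow, gowersU3Energy, hderiv, ← Complex.ofReal_expect, Complex.norm_real,
    Real.norm_eq_abs, sq_abs, sq (𝔼 _, _), expect_mul_expect]
  rw [expect_comm]
  refine expect_congr rfl fun h _ => ?_
  rw [expect_comm]
  refine expect_congr rfl fun k _ => expect_congr rfl fun x _ => ?_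
  rw [expect_eq_expect_add_left x fun y => _ * (f y * f (y + h) * f (y + k) * f (y + h + k))]
  refine expect_congr rfl fun y _ => ?_
  rw [add_right_comm x h y, add_right_comm x k y, add_right_comm (x + h) k y,
    add_right_comm x h y]
  ring

theorem gowersU3_le_of_gowersU3Energy_le {f : F5Vec n → ℝ} {δ : ℝ} (hδ : 0 ≤ δ)
    (hf : gowersU3Energy (fun x => (f x : ℂ)) ≤ δ ^ 8) : gowersU3 f ≤ δ := by
  rw [← gowersU3Pow_eq_gowersU3Energy] at hf
  calc gowersU3 f ≤ (δ ^ 8) ^ (1 / 8 : ℝ) :=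
        Real.rpow_le_rpow (gowersU3Pow_nonneg f) hf (by norm_num)
    _ = δ := by
        rw [← Real.rpow_natCast, ← Real.rpow_mul hδ]
        norm_num

end QuadraticFactors

theorem mainTheorem5_general {p : ℕ} [Fact p.Prime] [NeZero (2 : ZMod p)] {ε : ℝ} (hε : 0 < ε) :
    ∃ C : ℕ, ∀ {V : Type*} [AddCommGroup V] [Module (ZMod p) V] [Fintype V]
      (R₀ : Finset (Module.Dual (ZMod p) V)) (Q₀ : Finset (QuadraticForm (ZMod p) V))
      {f : V → ℂ}, (∀ x, ‖f x‖ ≤ 1) →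
      ∃ R Q, R₀ ⊆ R ∧ Q₀ ⊆ Q ∧ R.card ≤ R₀.card + C ∧ Q.card ≤ Q₀.card + C ∧
        gowersU3Energy (fun x => f x - classAverage (quadraticSetoid R Q) f x) ≤ ε := by
  have hc : 0 < affineCorrelation p (ε / 256) ^ 20 :=
    pow_pos (affineCorrelation_pos (by positivity)) 20
  obtain ⟨m, hm⟩ := exists_nat_gt (1 / affineCorrelation p (ε / 256) ^ 20)
  refine ⟨m * (⌊1 / affineCorrelation p (ε / 256) ^ 4⌋₊ + 1), fun {V} _ _ _ R₀ Q₀ f hf => ?_⟩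
  obtain ⟨R, Q, hR₀, hQ₀, hR, hQ, hsmall⟩ :=
    exists_refinement_of_one_lt_energy_add hf hε m R₀ Q₀
      (lt_add_of_nonneg_of_lt (Finset.expect_nonneg fun x _ => by positivity)
        ((div_lt_iff₀ hc).1 hm))
  refine ⟨R, Q, hR₀, hQ₀, hR, hQ.trans ?_, hsmall⟩
  gcongr
  exact Nat.le_mul_of_pos_right _ (Nat.succ_pos _)

theorem mainTheorem5 (δ : ℝ) (hδ : 0 < δ) :
    ∃ C : ℕ, ∀ (n d₁ d₂ : ℕ) (B₁₀ B₂₀ : MeasurableSpace (F5Vec n)),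
      IsQuadraticFactorLE B₁₀ B₂₀ d₁ d₂ →
      ∀ f : F5Vec n → ℝ, (∀ x, f x ∈ Set.Icc (-1 : ℝ) 1) →
        ∃ B₁ B₂ : MeasurableSpace (F5Vec n),
          IsQuadraticFactorLE B₁ B₂ (d₁ + C) (d₂ + C) ∧
          RefinesFactor B₁ B₁₀ ∧ RefinesFactor B₂ B₂₀ ∧
          ∃ f₁ f₂ : F5Vec n → ℝ,
            f = f₁ + f₂ ∧ f₁ = condAvg f B₂ ∧ gowersU3 f₂ ≤ δ := by
  have : NeZero (2 : ZMod 5) := ⟨by decide⟩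
  have : Fact (Nat.Prime 5) := ⟨Nat.prime_five⟩
  obtain ⟨C, hC⟩ := mainTheorem5_general (p := 5) (pow_pos hδ 8)
  refine ⟨C, fun n d₁ d₂ B₁₀ B₂₀ hB f hf => ?_⟩
  obtain ⟨R₀, Q₀, hR₀, hQ₀, rfl, rfl⟩ := isQuadraticFactorLE_iff.1 hB
  obtain ⟨R, Q, hRR₀, hQQ₀, hR, hQ, hsmall⟩ := hC R₀ Q₀ (f := fun x => (f x : ℂ)) fun x =>
    (Complex.norm_real _).trans_le (abs_le.2 (hf x))
  refine ⟨dualFactor R, quadraticFormFactor R Q,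
    isQuadraticFactorLE_iff.2 ⟨R, Q, by omega, by omega, rfl, rfl⟩,
    refinesFactor_of_le (dualFactor_mono hRR₀),
    refinesFactor_of_le (quadraticFormFactor_mono hRR₀ hQQ₀),
    _, _, (add_sub_cancel _ f).symm, rfl, gowersU3_le_of_gowersU3Energy_le hδ.le ?_⟩
  simpa only [Pi.sub_apply, Complex.ofReal_sub, ofReal_condAvg_quadraticFormFactor] using hsmall
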